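/- All graphs are finite and simple; the girth is the length of a shortest cycle. A graph is $K_4$-minor-free if it does not contain four pairwise disjoint connected subgraphs any two of which are joined by an edge. Let $k \ge 2$. (a) Every $K_4$-minor-free graph on $n$ vertices of girth $2k$ has at most $\frac{k}{k-1}(n-2)$ edges. (b) Let $s \ge 2$ and $n = s(k-1)+2$. Every graph consisting of $s$ internally disjoint paths, each with $k$ edges, between two distinct vertices $u$ and $v$ (such graphs exist) has $n$ vertices, is $K_4$-minor-free, has girth $2k$, and has exactly $\frac{k}{k-1}(n-2)$ edges, so the bound in (a) is attained for this $n$. (c) Conversely, for $s \ge 2$ and $n = s(k-1)+2$, every $K_4$-minor-free graph on $n$ vertices of girth $2k$ with exactly $\frac{k}{k-1}(n-2)$ edges consists of $s$ internally disjoint paths with $k$ edges between two distinct vertices. -/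

import Mathlib

universe u

/-- `G` contains the complete graph `K_t` as a minor: there are `t` pairwise disjoint connected
(in particular nonempty) parts of `G`, any two of which are joined by an edge of `G`. -/
def HasCompleteMinor {V : Type*} (t : ℕ) (G : SimpleGraph V) : Prop :=
  ∃ B : Fin t → Set V,
    (∀ i, (G.induce (B i)).Connected) ∧
    (∀ i j, i ≠ j → Disjoint (B i) (B j)) ∧
    (∀ i j, i ≠ j → ∃ x ∈ B i, ∃ y ∈ B j, G.Adj x y)

/-- `G` is `K_t`-minor-free. -/
def IsCompleteMinorFree {V : Type*} (t : ℕ) (G : SimpleGraph V) : Prop :=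
  ¬ HasCompleteMinor t G

/-- `G` consists of `s` internally disjoint paths, each with `k` edges, joining two distinct
vertices `u` and `v`: every vertex and every edge of `G` lies on one of the paths. (For `k ≥ 2`,
internal disjointness makes the `s` paths distinct and edge-disjoint.) -/
def IsUnionOfDisjointPaths {V : Type*} (G : SimpleGraph V) (s k : ℕ) : Prop :=
  ∃ (u v : V) (P : Fin s → G.Walk u v),
    u ≠ v ∧
    (∀ i, (P i).IsPath ∧ (P i).length = k) ∧
    (∀ i j, i ≠ j → ∀ x, x ∈ (P i).support → x ∈ (P j).support → x = u ∨ x = v) ∧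
    (∀ x : V, ∃ i, x ∈ (P i).support) ∧
    (∀ e ∈ G.edgeSet, ∃ i, e ∈ (P i).edges)

/-! Write m and n for the numbers of edges and vertices. The bound says that the defect k(n - 2) -
(k - 1)m is nonnegative. It is proved by induction on n, with the girth condition weakened to "some
cycle exists and every cycle has length at least 2k", which passes to every induced subgraph that
still contains a cycle.

Deleting a vertex of degree at most one lowers the defect. If there is none, K₄-minor-freeness
provides two distinct paths with the same ends all of whose inner vertices have degree two
(`exists_paths_inner_degree_two`). They contain a cycle, so one of them has length l ≥ k. Removing
its inner vertices removes l - 1 vertices and at most l edges, and lowers the defect by at least l -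
k. Once only a forest remains, m ≤ n, and this case is settled directly
(`extremal_of_ncard_edgeSet_le_card`).

The two paths come from Dirac's theorem that a K₄-minor-free graph has a vertex of degree at most
two: either this vertex lies in a triangle, which gives the paths, or it is suppressed and the paths
of the smaller graph are lifted.

Equality forces l = k and equality for the smaller graph, which by induction is a union of disjoint
paths of length k. The removed path is an ear on it, and `IsUnionOfDisjointPaths.of_ear` shows that
any position of the ear that does not give such a union again creates a short cycle or a K₄-minor.

For the converse, all vertices of a union of paths except the two ends have degree two. So a
connected set avoiding the ends has at most two outer neighbours, too few for a part of a K₄-minor,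
and every cycle contains two of the paths entirely. -/

open SimpleGraph

/-! ### Complete minors under subgraphs and contractions -/

section Minors

variable {V W : Type*}

/-- The image of a vertex set under a graph homomorphism induces a connected graph if the set
does. -/
theorem SimpleGraph.Hom.connected_induce_image {G : SimpleGraph V} {H : SimpleGraph W} (f : G →g H)
    {s : Set V} (hs : (G.induce s).Connected) : (H.induce (f '' s)).Connected := by
  let g : G.induce s →g H.induce (f '' s) :=
    ⟨fun x => ⟨f x, x, x.2, rfl⟩, fun {a b} h => f.map_rel h⟩
  refine hs.map g ?_
  rintro ⟨_, x, hx, rfl⟩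
  exact ⟨⟨x, hx⟩, rfl⟩

/-- A graph mapping injectively into `H` has no larger complete minors than `H`. -/
theorem HasCompleteMinor.map {t : ℕ} {G : SimpleGraph V} {H : SimpleGraph W} (f : G →g H)
    (hf : Function.Injective f) (h : HasCompleteMinor t G) : HasCompleteMinor t H := by
  obtain ⟨B, hB, hd, ha⟩ := h
  refine ⟨fun i => f '' B i, fun i => f.connected_induce_image (hB i), fun i j hij => ?_,
    fun i j hij => ?_⟩
  · exact (Set.disjoint_image_iff hf).2 (hd i j hij)
  · obtain ⟨x, hx, y, hy, h⟩ := ha i j hij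
    exact ⟨f x, ⟨x, hx, rfl⟩, f y, ⟨y, hy, rfl⟩, f.map_rel h⟩

theorem HasCompleteMinor.of_induce {t : ℕ} {G : SimpleGraph V} {s : Set V}
    (h : HasCompleteMinor t (G.induce s)) : HasCompleteMinor t G :=
  h.map (Embedding.induce s).toHom Subtype.val_injective

/-- Preimages of connected sets under a map with connected fibres are connected. -/
theorem SimpleGraph.connected_induce_preimage {G : SimpleGraph V} (f : V → W)
    (hf : ∀ w, (G.induce (f ⁻¹' {w})).Connected) {s : Set W}
    (hs : ((G.map f).induce s).Connected) : (G.induce (f ⁻¹' s)).Connected := by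
  have fib : ∀ x y (hx : x ∈ f ⁻¹' s) (hy : y ∈ f ⁻¹' s), f x = f y →
      (G.induce (f ⁻¹' s)).Reachable ⟨x, hx⟩ ⟨y, hy⟩ := by
    intro x y hx hy hxy
    have hle : f ⁻¹' {f x} ⊆ f ⁻¹' s := by
      intro z hz
      have hz' : f z = f x := hz
      change f z ∈ s
      rw [hz']
      exact hx
    exact ((hf (f x)).preconnected ⟨x, rfl⟩ ⟨y, hxy.symm⟩).map (G.induceHomOfLE hle).toHom
  -- A walk in the image is lifted edge by edge; between consecutive lifted edges one moves inside a
  -- fibre.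
  have key : ∀ a b (p : ((G.map f).induce s).Walk a b), ∀ x y (hx : x ∈ f ⁻¹' s)
      (hy : y ∈ f ⁻¹' s), f x = a → f y = b →
      (G.induce (f ⁻¹' s)).Reachable ⟨x, hx⟩ ⟨y, hy⟩ := by
    intro a b p
    induction p with
    | nil => exact fun x y hx hy h1 h2 => fib x y hx hy (h1.trans h2.symm)
    | @cons a c b h p ih =>
      intro x y hx hy h1 h2
      obtain ⟨-, p', q', hpq, hp', hq'⟩ := h
      have hps : p' ∈ f ⁻¹' s := by
        change f p' ∈ s
        rw [hp']
        exact a.2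
      have hqs : q' ∈ f ⁻¹' s := by
        change f q' ∈ s
        rw [hq']
        exact c.2
      exact (fib x p' hx hps (h1.trans hp'.symm)).trans
        ((Adj.reachable (G := G.induce (f ⁻¹' s)) (u := ⟨p', hps⟩) (v := ⟨q', hqs⟩) hpq).trans
          (ih q' y hqs hy hq' h2))
  obtain ⟨⟨w, hw⟩⟩ := hs.nonempty
  obtain ⟨⟨x, hx⟩⟩ := (hf w).nonempty
  have hx' : f x = w := hx
  have : Nonempty ↥(f ⁻¹' s) := ⟨⟨x, by change f x ∈ s; rw [hx']; exact hw⟩⟩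
  refine ⟨?_⟩
  rintro ⟨x, hx⟩ ⟨y, hy⟩
  obtain ⟨p⟩ := hs.preconnected ⟨f x, hx⟩ ⟨f y, hy⟩
  exact key _ _ p x y hx hy rfl rfl

/-- A complete minor of a contraction is a complete minor of the graph itself. -/
theorem HasCompleteMinor.of_map {t : ℕ} {G : SimpleGraph V} (f : V → W)
    (hf : ∀ w, (G.induce (f ⁻¹' {w})).Connected) (h : HasCompleteMinor t (G.map f)) :
    HasCompleteMinor t G := by
  obtain ⟨B, hB, hd, ha⟩ := h
  refine ⟨fun i => f ⁻¹' B i, fun i => connected_induce_preimage f hf (hB i),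
    fun i j hij => (hd i j hij).preimage f, fun i j hij => ?_⟩
  obtain ⟨x, hx, y, hy, -, p, q, hpq, rfl, rfl⟩ := ha i j hij
  exact ⟨p, hx, q, hy, hpq⟩

theorem hasCompleteMinor_four_of_sets {G : SimpleGraph V} {A B C D : Set V}
    (hA : (G.induce A).Connected) (hB : (G.induce B).Connected) (hC : (G.induce C).Connected)
    (hD : (G.induce D).Connected) (hAB : Disjoint A B) (hAC : Disjoint A C) (hAD : Disjoint A D)
    (hBC : Disjoint B C) (hBD : Disjoint B D) (hCD : Disjoint C D)
    (aAB : ∃ x ∈ A, ∃ y ∈ B, G.Adj x y) (aAC : ∃ x ∈ A, ∃ y ∈ C, G.Adj x y)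
    (aAD : ∃ x ∈ A, ∃ y ∈ D, G.Adj x y) (aBC : ∃ x ∈ B, ∃ y ∈ C, G.Adj x y)
    (aBD : ∃ x ∈ B, ∃ y ∈ D, G.Adj x y) (aCD : ∃ x ∈ C, ∃ y ∈ D, G.Adj x y) :
    HasCompleteMinor 4 G := by
  have flip : ∀ {S T : Set V}, (∃ x ∈ S, ∃ y ∈ T, G.Adj x y) → ∃ x ∈ T, ∃ y ∈ S, G.Adj x y :=
    fun ⟨x, hx, y, hy, h⟩ => ⟨y, hy, x, hx, h.symm⟩
  refine ⟨![A, B, C, D], fun i => ?_, fun i j hij => ?_, fun i j hij => ?_⟩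
  · fin_cases i
    exacts [hA, hB, hC, hD]
  · fin_cases i <;> fin_cases j
    exacts [absurd rfl hij, hAB, hAC, hAD, hAB.symm, absurd rfl hij, hBC, hBD, hAC.symm, hBC.symm,
      absurd rfl hij, hCD, hAD.symm, hBD.symm, hCD.symm, absurd rfl hij]
  · fin_cases i <;> fin_cases j
    exacts [absurd rfl hij, aAB, aAC, aAD, flip aAB, absurd rfl hij, aBC, aBD, flip aAC, flip aBC,
      absurd rfl hij, aCD, flip aAD, flip aBD, flip aCD, absurd rfl hij]

end Minors

/-! ### Contracting one edge -/

section Contraction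

variable {V : Type*} {G : SimpleGraph V} {u v : V}

open Classical in
/-- The map identifying `v` with `u`. -/
noncomputable def mergeVertex (huv : u ≠ v) (x : V) : {x : V // x ≠ v} :=
  if h : x = v then ⟨u, huv⟩ else ⟨x, h⟩

theorem mergeVertex_self (huv : u ≠ v) : mergeVertex huv v = ⟨u, huv⟩ := by
  simp [mergeVertex]

theorem mergeVertex_of_ne (huv : u ≠ v) {x : V} (hx : x ≠ v) : mergeVertex huv x = ⟨x, hx⟩ := by
  simp [mergeVertex, hx]

theorem mergeVertex_eq_iff (huv : u ≠ v) {x y : V} (hy : y ≠ v) :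
    mergeVertex huv x = ⟨y, hy⟩ ↔ x = y ∨ x = v ∧ y = u := by
  by_cases hx : x = v
  · subst hx
    rw [mergeVertex_self]
    simp only [Subtype.mk.injEq, true_and]
    constructor
    · exact fun h => Or.inr h.symm
    · rintro (h | h)
      · exact absurd h.symm hy
      · exact h.symm
  · rw [mergeVertex_of_ne huv hx]
    simp [hx]

theorem mergeVertex_injOn (huv : u ≠ v) {s : Set V} (hs : ¬ (u ∈ s ∧ v ∈ s)) :
    Set.InjOn (mergeVertex huv) s := by
  intro x hx y hy hxy
  by_cases h : y = v
  · subst h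
    rw [mergeVertex_self, mergeVertex_eq_iff] at hxy
    rcases hxy with rfl | ⟨rfl, -⟩
    · exact absurd ⟨hx, hy⟩ hs
    · rfl
  · rw [mergeVertex_of_ne huv h, mergeVertex_eq_iff] at hxy
    rcases hxy with rfl | ⟨rfl, rfl⟩
    · rfl
    · exact absurd ⟨hy, hx⟩ hs

theorem connected_induce_mergeVertex_fibre (h : G.Adj u v) (w : {x : V // x ≠ v}) :
    (G.induce (mergeVertex h.ne ⁻¹' {w})).Connected := by
  obtain ⟨w, hw⟩ := w
  by_cases hwu : w = u
  · subst hwu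
    have : mergeVertex h.ne ⁻¹' {⟨w, hw⟩} = {w, v} := by
      ext x
      simp [mergeVertex_eq_iff]
    rw [this]
    exact induce_pair_connected_of_adj h
  · have : mergeVertex h.ne ⁻¹' {⟨w, hw⟩} = {w} := by
      ext x
      simp [mergeVertex_eq_iff, hwu]
    rw [this]
    exact Connected.of_subsingleton

theorem neighborSet_map_mergeVertex (huv : u ≠ v) {x : V} (hxv : x ≠ v) (hxu : x ≠ u) :
    (G.map (mergeVertex huv)).neighborSet ⟨x, hxv⟩ = mergeVertex huv '' G.neighborSet x := by
  ext y
  constructor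
  · rintro ⟨-, p, q, hpq, hp, rfl⟩
    rw [mergeVertex_eq_iff] at hp
    rcases hp with rfl | ⟨-, rfl⟩
    · exact ⟨q, hpq, rfl⟩
    · exact absurd rfl hxu
  · rintro ⟨z, hz, rfl⟩
    refine ⟨?_, x, z, hz, mergeVertex_of_ne huv hxv, rfl⟩
    intro h
    have h := h.symm
    rw [mergeVertex_eq_iff] at h
    rcases h with rfl | ⟨-, rfl⟩
    · exact G.loopless.irrefl _ hz
    · exact absurd rfl hxu

/-- The merging map is injective on a neighbourhood that does not contain both `u` and `v`, so among
the vertices other than these two only common neighbours can lose degree. -/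
theorem ncard_neighborSet_map_mergeVertex (huv : u ≠ v) {x : V} (hxv : x ≠ v) (hxu : x ≠ u)
    (hx : ¬ (G.Adj x u ∧ G.Adj x v)) :
    ((G.map (mergeVertex huv)).neighborSet ⟨x, hxv⟩).ncard = (G.neighborSet x).ncard := by
  rw [neighborSet_map_mergeVertex huv hxv hxu]
  exact (mergeVertex_injOn huv hx).ncard_image

end Contraction

/-! ### Degrees -/

section Degree

variable {V : Type*} {G : SimpleGraph V}

/-- Inducing on a set containing all neighbours of a vertex does not change its degree. -/
theorem ncard_neighborSet_induce {s : Set V} (x : s) (h : ∀ y, G.Adj x y → y ∈ s) :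
    ((G.induce s).neighborSet x).ncard = (G.neighborSet (x : V)).ncard := by
  rw [← Set.ncard_image_of_injective _ Subtype.val_injective]
  congr 1
  ext y
  constructor
  · rintro ⟨z, hz, rfl⟩
    exact hz
  · exact fun hy => ⟨⟨y, h y hy⟩, hy, rfl⟩

theorem exists_adj_of_ncard [Finite V] {x : V} {s : Finset V}
    (h : s.card < (G.neighborSet x).ncard) : ∃ y, G.Adj x y ∧ y ∉ s := by
  by_contra! hc
  have : (G.neighborSet x).ncard ≤ (s : Set V).ncard :=
    Set.ncard_le_ncard (fun y hy => hc y hy) (Set.toFinite _)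
  rw [Set.ncard_coe_finset] at this
  omega

end Degree

/-! ### Dirac's theorem: minimum degree three forces a K₄-minor -/

section Dirac

/-- A graph with an edge `uv` and at least one more vertex, in which every vertex other than
`u` and `v` has degree at least three, contains `K₄` as a minor. -/
theorem hasCompleteMinor_four_of_adj (n : ℕ) : ∀ (V : Type u) [Finite V] (G : SimpleGraph V)
    (u v w : V), Nat.card V = n → G.Adj u v → w ≠ u → w ≠ v →
    (∀ x, x ≠ u → x ≠ v → 3 ≤ (G.neighborSet x).ncard) → HasCompleteMinor 4 G := by
  classical
  induction n using Nat.strong_induction_on with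
  | _ n ih =>
  intro V _ G u v w hn huv hwu hwv hdeg
  -- restricting to a proper subset containing all neighbours of its ordinary vertices
  have restrict : ∀ (s : Set V) (a b c z : V), a ∈ s → b ∈ s → c ∈ s → z ∉ s → G.Adj a b →
      c ≠ a → c ≠ b → (∀ x ∈ s, x ≠ a → x ≠ b → 3 ≤ (G.neighborSet x).ncard) →
      (∀ x ∈ s, x ≠ a → x ≠ b → ∀ y, G.Adj x y → y ∈ s) → HasCompleteMinor 4 G := by
    intro s a b c z ha hb hc hz hab hca hcb hd hcl
    have hlt : Nat.card s < n := by
      rw [← hn, Nat.card_coe_set_eq, ← Set.ncard_univ]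
      exact Set.ncard_lt_ncard ⟨Set.subset_univ _, fun h => hz (h (Set.mem_univ z))⟩
    refine (ih _ hlt s (G.induce s) ⟨a, ha⟩ ⟨b, hb⟩ ⟨c, hc⟩ rfl hab
      (by simpa using hca) (by simpa using hcb) ?_).of_induce
    intro x hxa hxb
    have hxa' : (x : V) ≠ a := fun h => hxa (Subtype.ext h)
    have hxb' : (x : V) ≠ b := fun h => hxb (Subtype.ext h)
    rw [ncard_neighborSet_induce x (hcl x x.2 hxa' hxb')]
    exact hd x x.2 hxa' hxb'
  let T : Set V := {x | x ≠ u ∧ x ≠ v}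
  -- If removing `u` and `v` disconnects the graph, one component together with `u` and `v` is
  -- smaller, and its ordinary vertices keep all their neighbours.
  by_cases hconn : (G.induce T).Preconnected
  swap
  · simp only [Preconnected, not_forall] at hconn
    obtain ⟨x, y, hxy⟩ := hconn
    refine restrict {z | z = u ∨ z = v ∨ ∃ h : z ∈ T, (G.induce T).Reachable x ⟨z, h⟩} u v x y
      (Or.inl rfl) (Or.inr (Or.inl rfl)) (Or.inr (Or.inr ⟨x.2, Reachable.refl _⟩)) ?_ huv
      x.2.1 x.2.2 (fun z _ => hdeg z) ?_
    · rintro (h | h | ⟨h, h'⟩)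
      · exact y.2.1 h
      · exact y.2.2 h
      · exact hxy h'
    · rintro z (h | h | ⟨h, h'⟩) hzu hzv q hzq
      · exact absurd h hzu
      · exact absurd h hzv
      · by_cases hqu : q = u
        · exact Or.inl hqu
        by_cases hqv : q = v
        · exact Or.inr (Or.inl hqv)
        refine Or.inr (Or.inr ⟨⟨hqu, hqv⟩, h'.trans ?_⟩)
        exact Adj.reachable (G := G.induce T) (u := ⟨z, h⟩) (v := ⟨q, hqu, hqv⟩) hzq
  -- Two common neighbours `x`, `y` are joined by a path avoiding `u` and `v`. The four parts are
  -- `u`, `v`, `x` and the rest of that path, which contains `y`.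
  by_cases htwo : ∃ x y, x ≠ y ∧ G.Adj x u ∧ G.Adj x v ∧ G.Adj y u ∧ G.Adj y v
  · obtain ⟨x, y, hxy, hxu, hxv, hyu, hyv⟩ := htwo
    obtain ⟨p, hp⟩ := hconn.exists_isPath ⟨x, hxu.ne, hxv.ne⟩ ⟨y, hyu.ne, hyv.ne⟩
    cases p with
    | nil => exact absurd rfl hxy
    | @cons _ c _ h p =>
    rw [Walk.cons_isPath_iff] at hp
    let P : Set V := (Embedding.induce (G := G) T).toHom '' {z | z ∈ p.support}
    have hP : (G.induce P).Connected :=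
      (Embedding.induce (G := G) T).toHom.connected_induce_image p.connected_induce_support
    have hPT : ∀ z ∈ P, z ≠ u ∧ z ≠ v := by
      rintro _ ⟨z, -, rfl⟩
      exact z.2
    have hyP : y ∈ P := ⟨_, p.end_mem_support, rfl⟩
    have hcP : (c : V) ∈ P := ⟨_, p.start_mem_support, rfl⟩
    have hxP : x ∉ P := by
      rintro ⟨z, hz, hzx⟩
      apply hp.2
      have : z = ⟨x, hxu.ne, hxv.ne⟩ := Subtype.ext hzx
      rwa [← this]
    have hxc : G.Adj x c := h
    have huP : u ∉ P := fun h => (hPT u h).1 rfl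
    have hvP : v ∉ P := fun h => (hPT v h).2 rfl
    have hsing : ∀ a : V, (G.induce ({a} : Set V)).Connected := fun a => Connected.of_subsingleton
    exact hasCompleteMinor_four_of_sets (hsing u) (hsing v) (hsing x) hP
      (by simpa using huv.ne) (by simpa using hxu.ne') (by simpa using huP)
      (by simpa using hxv.ne') (by simpa using hvP) (by simpa using hxP)
      ⟨u, rfl, v, rfl, huv⟩ ⟨u, rfl, x, rfl, hxu.symm⟩ ⟨u, rfl, y, hyP, hyu.symm⟩
      ⟨v, rfl, x, rfl, hxv.symm⟩ ⟨v, rfl, y, hyP, hyv.symm⟩ ⟨x, rfl, c, hcP, hxc⟩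
  push Not at htwo
  -- Contract `uv` and take the contracted vertex and `x` as the new exceptional pair. Only common
  -- neighbours of `u` and `v` lose degree, and `x` is the only one possible. The required third
  -- vertex is a neighbour of `x` outside `u`, `v`.
  have key : ∀ x, x ≠ u → x ≠ v → (G.Adj x u ∨ G.Adj x v) →
      (∀ y, y ≠ x → ¬ (G.Adj y u ∧ G.Adj y v)) → HasCompleteMinor 4 G := by
    intro x hxu hxv hx hcom
    obtain ⟨c, hcu, hcv, hcx⟩ : ∃ c, c ≠ u ∧ c ≠ v ∧ c ≠ x := by
      obtain ⟨c, hc, hc'⟩ := exists_adj_of_ncard (G := G) (x := x) (s := {u, v})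
        (lt_of_le_of_lt (Finset.card_le_two) (hdeg x hxu hxv))
      simp only [Finset.mem_insert, Finset.mem_singleton, not_or] at hc'
      exact ⟨c, hc'.1, hc'.2, hc.ne'⟩
    have hlt : Nat.card {x : V // x ≠ v} < n := by
      rw [← hn]
      exact Finite.card_subtype_lt (x := v) (by simp)
    refine HasCompleteMinor.of_map (mergeVertex huv.ne) (connected_induce_mergeVertex_fibre huv)
      (ih _ hlt _ _ ⟨u, huv.ne⟩ ⟨x, hxv⟩ ⟨c, hcv⟩ rfl ⟨?_, ?_⟩ ?_ ?_ ?_)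
    · simpa using Ne.symm hxu
    · rcases hx with hx | hx
      · exact ⟨u, x, hx.symm, mergeVertex_of_ne _ _, mergeVertex_of_ne _ _⟩
      · exact ⟨v, x, hx.symm, mergeVertex_self _, mergeVertex_of_ne _ _⟩
    · simpa using hcu
    · simpa using hcx
    · rintro ⟨z, hzv⟩ hzu hzx
      have hzu' : z ≠ u := fun h => hzu (Subtype.ext h)
      have hzx' : z ≠ x := fun h => hzx (Subtype.ext h)
      rw [ncard_neighborSet_map_mergeVertex huv.ne hzv hzu' (hcom z hzx')]
      exact hdeg z hzu' hzv
  by_cases hone : ∃ x, G.Adj x u ∧ G.Adj x v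
  · obtain ⟨x, hxu, hxv⟩ := hone
    exact key x hxu.ne hxv.ne (Or.inl hxu) fun y hy h => htwo x y hy.symm hxu hxv h.1 h.2
  by_cases hnb : ∃ x, x ≠ u ∧ x ≠ v ∧ (G.Adj x u ∨ G.Adj x v)
  · obtain ⟨x, hxu, hxv, hx⟩ := hnb
    exact key x hxu hxv hx fun y _ h => hone ⟨y, h⟩
  push Not at hnb
  -- Now no edge joins `T` to `u` or `v`, so `T` is closed under adjacency and any edge `wc` inside
  -- it can serve as the exceptional pair.
  obtain ⟨c, hc, -⟩ := exists_adj_of_ncard (G := G) (x := w) (s := ∅)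
    (lt_of_lt_of_le (by simp) (hdeg w hwu hwv))
  obtain ⟨d, hd, hd'⟩ := exists_adj_of_ncard (G := G) (x := w) (s := {c})
    (lt_of_lt_of_le (by simp) (hdeg w hwu hwv))
  have hcl : ∀ x ∈ T, ∀ y, G.Adj x y → y ∈ T := by
    rintro x ⟨hxu, hxv⟩ y hxy
    have := hnb x hxu hxv
    constructor
    · rintro rfl
      exact this.1 hxy
    · rintro rfl
      exact this.2 hxy
  exact restrict T w c d u ⟨hwu, hwv⟩ (hcl w ⟨hwu, hwv⟩ c hc) (hcl w ⟨hwu, hwv⟩ d hd)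
    (fun h => h.1 rfl) hc hd.ne' (by simpa using hd') (fun x hx _ _ => hdeg x hx.1 hx.2)
    (fun x hx _ _ => hcl x hx)

/-- A nonempty `K₄`-minor-free graph has a vertex of degree at most two. -/
theorem IsCompleteMinorFree.exists_ncard_neighborSet_le_two {V : Type u} [Finite V] [Nonempty V]
    {G : SimpleGraph V} (h : IsCompleteMinorFree 4 G) : ∃ x, (G.neighborSet x).ncard ≤ 2 := by
  classical
  by_contra! hc
  obtain ⟨u⟩ := ‹Nonempty V›
  obtain ⟨v, hv, -⟩ := exists_adj_of_ncard (G := G) (x := u) (s := ∅)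
    (lt_trans (by simp) (hc u))
  obtain ⟨w, hw, hw'⟩ := exists_adj_of_ncard (G := G) (x := u) (s := {v})
    (lt_of_le_of_lt (by simp) (hc u))
  exact h (hasCompleteMinor_four_of_adj _ V G u v w rfl hv hw.ne' (by simpa using hw')
    fun x _ _ => hc x)

end Dirac

/-! ### Suppressing a vertex of degree two, and parallel paths with inner degree two -/

section Suppression

variable {V : Type*} {G : SimpleGraph V} {w : V}

/-- A walk in a graph obtained by suppressing the vertex `w` of degree two lifts to a walk passing
through `w` whenever the new edge is used. -/
theorem SimpleGraph.Walk.exists_lift_of_suppress [DecidableEq V] {H : SimpleGraph {x : V // x ≠ w}}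
    {a b : {x : V // x ≠ w}} (ha : G.Adj a w) (hb : G.Adj w b)
    (hH : ∀ x y, H.Adj x y → G.Adj x y ∨ s(x, y) = s(a, b)) {x y : {x : V // x ≠ w}}
    (p : H.Walk x y) :
    ∃ q : G.Walk (x : V) y, q.support.filter (· ≠ w) = p.support.map Subtype.val ∧
      q.support.count w ≤ p.edges.count s(a, b) := by
  induction p with
  | @nil x => exact ⟨Walk.nil, by simp [x.2], by simp [x.2]⟩
  | @cons x c y h p ih =>
    obtain ⟨q, hq, hq'⟩ := ih
    by_cases hs : s(x, c) = s(a, b)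
    · have hxw : G.Adj x w ∧ G.Adj w c := by
        rcases Sym2.eq_iff.1 hs with ⟨rfl, rfl⟩ | ⟨rfl, rfl⟩
        · exact ⟨ha, hb⟩
        · exact ⟨hb.symm, ha.symm⟩
      refine ⟨Walk.cons hxw.1 (Walk.cons hxw.2 q), ?_, ?_⟩
      · simp [x.2, ← hq]
      · simpa [x.2, hs] using hq'
    · refine ⟨Walk.cons ((hH x c h).resolve_right hs) q, ?_, ?_⟩
      · simp [x.2, ← hq]
      · simpa [x.2, List.count_cons, hs] using hq'

/-- A path uses the new edge at most once, so its lift meets `w` at most once; the other vertices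
appear as often as in the original path. -/
theorem SimpleGraph.Walk.IsPath.exists_lift_of_suppress [DecidableEq V]
    {H : SimpleGraph {x : V // x ≠ w}}
    {a b : {x : V // x ≠ w}} (ha : G.Adj a w) (hb : G.Adj w b)
    (hH : ∀ x y, H.Adj x y → G.Adj x y ∨ s(x, y) = s(a, b)) {x y : {x : V // x ≠ w}}
    {p : H.Walk x y} (hp : p.IsPath) :
    ∃ q : G.Walk (x : V) y, q.IsPath ∧
      q.support.filter (· ≠ w) = p.support.map Subtype.val := by
  obtain ⟨q, hq, hq'⟩ := p.exists_lift_of_suppress ha hb hH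
  refine ⟨q, ?_, hq⟩
  rw [Walk.isPath_def, List.nodup_iff_count_le_one]
  intro z
  by_cases hz : z = w
  · subst hz
    exact hq'.trans (hp.isTrail.count_edges_le_one _)
  · rw [← List.count_filter (p := (· ≠ w)) (by simpa using hz), hq]
    exact List.nodup_iff_count_le_one.1 (hp.support_nodup.map Subtype.val_injective) z

end Suppression

/-- In a nonempty `K₄`-minor-free graph of minimum degree at least two, two distinct paths with the
same ends have all their inner vertices of degree two. -/
theorem IsCompleteMinorFree.exists_paths_inner_degree_two (n : ℕ) : ∀ (V : Type u) [Finite V]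
    [Nonempty V] (G : SimpleGraph V), Nat.card V = n → IsCompleteMinorFree 4 G →
    (∀ x, 2 ≤ (G.neighborSet x).ncard) →
    ∃ (u v : V) (P Q : G.Walk u v), P.IsPath ∧ Q.IsPath ∧ P ≠ Q ∧
      ∀ x, x ∈ P.support ∨ x ∈ Q.support → x ≠ u → x ≠ v → (G.neighborSet x).ncard = 2 := by
  classical
  induction n using Nat.strong_induction_on with
  | _ n ih =>
  intro V _ _ G hn hG hdeg
  obtain ⟨w, hw⟩ := hG.exists_ncard_neighborSet_le_two
  have hw2 : (G.neighborSet w).ncard = 2 := le_antisymm hw (hdeg w)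
  obtain ⟨a, b, hab, hN⟩ := Set.ncard_eq_two.1 hw2
  have hNw : ∀ z, G.Adj w z ↔ z = a ∨ z = b := by
    intro z
    rw [← mem_neighborSet, hN]
    rfl
  have hwa : G.Adj w a := (hNw a).2 (Or.inl rfl)
  have hwb : G.Adj w b := (hNw b).2 (Or.inr rfl)
  -- In the triangle `a`, `w`, `b` the two paths are the edge `ab` and the detour through `w`.
  by_cases hadj : G.Adj a b
  · refine ⟨a, b, hadj.toWalk, Walk.cons hwa.symm hwb.toWalk, ?_, ?_, ?_, ?_⟩
    · exact hadj.isPath_toWalk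
    · simp [Walk.isPath_def, hwa.ne', hwb.ne, hab]
    · intro h
      simpa using congrArg Walk.length h
    · intro x hx hxa hxb
      have : x = w := by
        simpa [hxa, hxb] using hx
      rwa [this]
  have haw : a ≠ w := hwa.ne'
  have hbw : b ≠ w := hwb.ne'
  let H := G.map (mergeVertex haw)
  have hHadj : ∀ x y, H.Adj x y → G.Adj x y ∨ s(x, y) = s(⟨a, haw⟩, ⟨b, hbw⟩) := by
    rintro ⟨x, hx⟩ ⟨y, hy⟩ ⟨hne, p, q, hpq, hp, hq⟩
    rw [mergeVertex_eq_iff] at hp hq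
    rcases hp with rfl | ⟨rfl, rfl⟩ <;> rcases hq with rfl | ⟨rfl, rfl⟩
    · exact Or.inl hpq
    · rcases (hNw _).1 hpq.symm with rfl | rfl
      · exact absurd rfl hne
      · exact Or.inr Sym2.eq_swap
    · rcases (hNw _).1 hpq with rfl | rfl
      · exact absurd rfl hne
      · exact Or.inr rfl
    · exact absurd hpq (G.loopless.irrefl _)
  -- Suppression keeps all degrees: `a` exchanges its neighbour `w` for `b`, a new neighbour since
  -- `a` and `b` are not adjacent. No other vertex is adjacent to both `a` and `w`.
  have hdegH : ∀ x : {x : V // x ≠ w},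
      (H.neighborSet x).ncard = (G.neighborSet (x : V)).ncard := by
    rintro ⟨x, hxw⟩
    by_cases hxa : x = a
    · subst hxa
      have himg : Subtype.val '' (H.neighborSet ⟨x, hxw⟩) =
          insert b (G.neighborSet x \ {w}) := by
        ext z
        constructor
        · rintro ⟨⟨z, hz⟩, hxz, rfl⟩
          rcases hHadj _ _ hxz with h | h
          · exact Or.inr ⟨h, hz⟩
          · rcases Sym2.eq_iff.1 h with ⟨-, h⟩ | ⟨h, -⟩
            · exact Or.inl (congrArg Subtype.val h)
            · exact absurd (congrArg Subtype.val h) hab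
        · rintro (rfl | ⟨hz, hzw⟩)
          · exact ⟨⟨z, hbw⟩, ⟨by simpa using hab, w, z, hwb, mergeVertex_self _,
              mergeVertex_of_ne _ _⟩, rfl⟩
          · have hxz : G.Adj x z := hz
            exact ⟨⟨z, hzw⟩, ⟨fun h => hxz.ne (congrArg Subtype.val h), x, z, hz, mergeVertex_of_ne _ _,
              mergeVertex_of_ne _ _⟩, rfl⟩
      rw [← Set.ncard_image_of_injective _ Subtype.val_injective, himg,
        Set.ncard_insert_of_notMem (fun h => hadj h.1) (Set.toFinite _)]
      exact Set.ncard_sdiff_singleton_add_one hwa.symm (Set.toFinite _)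
    · refine ncard_neighborSet_map_mergeVertex haw hxw hxa ?_
      rintro ⟨h1, h2⟩
      rcases (hNw _).1 h2.symm with rfl | rfl
      · exact hxa rfl
      · exact hadj h1.symm
  have hlt : Nat.card {x : V // x ≠ w} < n := by
    rw [← hn]
    exact Finite.card_subtype_lt (x := w) (by simp)
  have : Nonempty {x : V // x ≠ w} := ⟨⟨a, haw⟩⟩
  obtain ⟨u, v, P, Q, hP, hQ, hPQ, hin⟩ := ih _ hlt _ H rfl
    (fun h => hG (h.of_map _ (connected_induce_mergeVertex_fibre hwa.symm)))
    (fun x => (hdegH x).symm ▸ hdeg x)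
  obtain ⟨P', hP', hPs⟩ := hP.exists_lift_of_suppress hwa.symm hwb hHadj
  obtain ⟨Q', hQ', hQs⟩ := hQ.exists_lift_of_suppress hwa.symm hwb hHadj
  refine ⟨u, v, P', Q', hP', hQ', ?_, ?_⟩
  · rintro rfl
    apply hPQ
    apply Walk.ext_support
    rw [hPs] at hQs
    exact List.map_injective_iff.2 Subtype.val_injective hQs
  · intro x hx hxu hxv
    by_cases hxw : x = w
    · rwa [hxw]
    rw [← hdegH ⟨x, hxw⟩]
    have aux : ∀ (R' : G.Walk (u : V) v) (R : H.Walk u v),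
        R'.support.filter (· ≠ w) = R.support.map Subtype.val → x ∈ R'.support →
        (⟨x, hxw⟩ : {x : V // x ≠ w}) ∈ R.support := by
      intro R' R h hx
      have : x ∈ R'.support.filter (· ≠ w) := by
        simpa using ⟨hx, hxw⟩
      rw [h] at this
      simpa [hxw] using this
    refine hin _ (hx.imp (aux _ _ hPs) (aux _ _ hQs)) ?_ ?_
    · exact fun h => hxu (congrArg Subtype.val h)
    · exact fun h => hxv (congrArg Subtype.val h)

/-! ### Paths, cycles and their inner vertices -/

section Walks

variable {V : Type*} {G : SimpleGraph V} {u v : V}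

theorem SimpleGraph.Walk.exists_getVert_of_inner {p : G.Walk u v} {z : V} (hz : z ∈ p.support)
    (hu : z ≠ u) (hv : z ≠ v) : ∃ i, i ≠ 0 ∧ i < p.length ∧ p.getVert i = z := by
  obtain ⟨i, rfl, hi⟩ := Walk.mem_support_iff_exists_getVert.1 hz
  refine ⟨i, ?_, lt_of_le_of_ne hi ?_, rfl⟩
  · rintro rfl
    exact hu p.getVert_zero
  · rintro rfl
    exact hv p.getVert_length

/-- A path passes through every inner vertex along all edges, if that vertex has degree two. -/
theorem SimpleGraph.Walk.IsPath.mem_edges_of_inner_degree_two [Finite V] {p : G.Walk u v}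
    (hp : p.IsPath) {x y : V} (hx : x ∈ p.support) (hu : x ≠ u) (hv : x ≠ v)
    (hd : (G.neighborSet x).ncard = 2) (hxy : G.Adj x y) : s(x, y) ∈ p.edges := by
  obtain ⟨i, hi0, hi, rfl⟩ := Walk.exists_getVert_of_inner hx hu hv
  have h2 := hp.ncard_neighborSet_toSubgraph_internal_eq_two hi0 hi
  have := Set.eq_of_subset_of_ncard_le (p.toSubgraph.neighborSet_subset (p.getVert i))
    (by rw [hd, h2]) (Set.toFinite _)
  have hy : y ∈ G.neighborSet (p.getVert i) := hxy
  rw [← this] at hy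
  exact p.adj_toSubgraph_iff_mem_edges.1 hy

theorem SimpleGraph.Walk.IsPath.ncard_inner {p : G.Walk u v} (hp : p.IsPath) (huv : u ≠ v) :
    {x | x ∈ p.support ∧ x ≠ u ∧ x ≠ v}.ncard = p.length - 1 := by
  classical
  have : {x | x ∈ p.support ∧ x ≠ u ∧ x ≠ v} = ((p.support.toFinset \ {u, v} : Finset V) : Set V) := by
    ext x
    simp
  rw [this, Set.ncard_coe_finset, Finset.card_sdiff_of_subset, List.toFinset_card_of_nodup
    hp.support_nodup, Walk.length_support, Finset.card_pair huv]
  · omega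
  · intro x hx
    simp only [Finset.mem_insert, Finset.mem_singleton] at hx
    rcases hx with rfl | rfl <;> simp

theorem SimpleGraph.Walk.IsTrail.ncard_edges {p : G.Walk u v} (hp : p.IsTrail) :
    {e | e ∈ p.edges}.ncard = p.length := by
  classical
  have : {e | e ∈ p.edges} = (p.edges.toFinset : Set (Sym2 V)) := by
    ext x
    simp
  rw [this, Set.ncard_coe_finset, ← p.length_edges, List.toFinset_card_of_nodup hp.edges_nodup]

/-- A path contains a path between any two of its vertices. -/
theorem SimpleGraph.Walk.IsPath.exists_isPath_between {p : G.Walk u v} (hp : p.IsPath) {x y : V}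
    (hx : x ∈ p.support) (hy : y ∈ p.support) : ∃ r : G.Walk x y, r.IsPath ∧
      r.length ≤ p.length ∧ (r.length = p.length → x = u ∧ y = v ∨ x = v ∧ y = u) := by
  obtain ⟨i, rfl, hi⟩ := Walk.mem_support_iff_exists_getVert.1 hx
  obtain ⟨j, rfl, hj⟩ := Walk.mem_support_iff_exists_getVert.1 hy
  have main : ∀ i j, i ≤ j → j ≤ p.length → ∃ r : G.Walk (p.getVert i) (p.getVert j), r.IsPath ∧
      r.length ≤ p.length ∧ (r.length = p.length → p.getVert i = u ∧ p.getVert j = v) := by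
    intro i j hij hj
    refine ⟨((p.drop i).take (j - i)).copy rfl ?_, ?_, ?_, ?_⟩
    · rw [Walk.drop_getVert, Nat.add_sub_cancel' hij]
    · rw [Walk.isPath_copy]
      exact (hp.drop i).take _
    · rw [Walk.length_copy, Walk.take_length, Walk.drop_length]
      omega
    · rw [Walk.length_copy, Walk.take_length, Walk.drop_length]
      intro h
      have h1 : i = 0 := by omega
      have h2 : j = p.length := by omega
      simp [h1, h2]
  rcases le_total i j with hij | hij
  · obtain ⟨r, h1, h2, h3⟩ := main i j hij hj
    exact ⟨r, h1, h2, fun h => Or.inl (h3 h)⟩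
  · obtain ⟨r, h1, h2, h3⟩ := main j i hij hi
    exact ⟨r.reverse, h1.reverse, by simpa using h2,
      fun h => Or.inr (h3 (by simpa using h)).symm⟩

/-- Two vertices split a cycle into two paths. -/
theorem SimpleGraph.Walk.IsCycle.exists_split {c : G.Walk u u} (hc : c.IsCycle) {t : ℕ}
    (ht0 : t ≠ 0) (ht : t < c.length) : ∃ A B : G.Walk u (c.getVert t), A.IsPath ∧ B.IsPath ∧
      A.length = t ∧ B.length = c.length - t ∧
      (∀ z, z ∈ A.support → z ∈ B.support → z = u ∨ z = c.getVert t) ∧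
      (∀ z, z ∈ c.support ↔ z ∈ A.support ∨ z ∈ B.support) ∧
      (∀ e, e ∈ c.edges ↔ e ∈ A.edges ∨ e ∈ B.edges) := by
  refine ⟨c.take t, (c.drop t).reverse, hc.isPath_take ht,
    (hc.isPath_drop (Nat.pos_of_ne_zero ht0)).reverse, ?_, ?_, ?_, ?_, ?_⟩
  · rw [Walk.take_length]
    omega
  · rw [Walk.length_reverse, Walk.drop_length]
  · intro z hz hz'
    rw [Walk.support_reverse, List.mem_reverse] at hz'
    obtain ⟨i, rfl, hi⟩ := Walk.mem_support_iff_exists_getVert.1 hz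
    obtain ⟨j, hj', hj⟩ := Walk.mem_support_iff_exists_getVert.1 hz'
    rw [Walk.take_length] at hi
    rw [Walk.drop_length] at hj
    have hit : t ⊓ i = i := min_eq_right (hi.trans (min_le_left _ _))
    rw [Walk.take_getVert, Walk.drop_getVert, hit] at hj'
    rw [Walk.take_getVert, hit]
    -- Positions on a cycle are injective only from 1 to its length, because the start is also the
    -- end; hence position 0 is treated apart.
    rcases Nat.eq_zero_or_pos i with rfl | hi0
    · exact Or.inl c.getVert_zero
    · have := hc.getVert_injOn (x₁ := t + j) (x₂ := i)
        (by constructor <;> omega) (by constructor <;> omega) hj'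
      have : i = t := by omega
      exact Or.inr (by rw [this])
  · intro z
    have h : z ∈ ((c.take t).append (c.drop t)).support ↔ _ := Walk.mem_support_append_iff _ _
    rwa [c.append_take_drop_eq, ← List.mem_reverse (as := (c.drop t).support),
      ← Walk.support_reverse] at h
  · intro e
    have h : e ∈ ((c.take t).append (c.drop t)).edges ↔
        e ∈ (c.take t).edges ∨ e ∈ (c.drop t).edges := by
      rw [Walk.edges_append, List.mem_append]
    rwa [c.append_take_drop_eq, ← List.mem_reverse (as := (c.drop t).edges),
      ← Walk.edges_reverse] at h

theorem SimpleGraph.Walk.IsCycle.length_le_card [Finite V] {c : G.Walk u u} (hc : c.IsCycle) :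
    c.length ≤ Nat.card V := by
  have := Fintype.ofFinite V
  rw [Nat.card_eq_fintype_card]
  have := hc.support_nodup.length_le_card
  simpa using this

theorem SimpleGraph.Walk.IsCycle.mem_support_of_length_eq_card [Finite V] {c : G.Walk u u}
    (hc : c.IsCycle) (h : c.length = Nat.card V) (z : V) : z ∈ c.support := by
  classical
  have := Fintype.ofFinite V
  have h1 : c.support.tail.toFinset = Finset.univ := by
    rw [← Finset.card_eq_iff_eq_univ, List.toFinset_card_of_nodup hc.support_nodup]
    simpa [Nat.card_eq_fintype_card] using h
  exact List.mem_of_mem_tail (List.mem_toFinset.1 (h1 ▸ Finset.mem_univ z))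

/-- The inner vertices of a path of length at least two induce a connected graph. -/
theorem SimpleGraph.Walk.IsPath.connected_induce_inner {p : G.Walk u v} (hp : p.IsPath)
    (hl : 2 ≤ p.length) : (G.induce {x | x ∈ p.support ∧ x ≠ u ∧ x ≠ v}).Connected := by
  -- The inner vertices are those at positions 1 to `p.length - 1`, the support of a subwalk with
  -- `p.length - 2` edges.
  have : {x | x ∈ p.support ∧ x ≠ u ∧ x ≠ v} =
      {x | x ∈ ((p.drop 1).take (p.length - 2)).support} := by
    ext z
    constructor
    · rintro ⟨hz, hzu, hzv⟩
      obtain ⟨i, hi0, hi, rfl⟩ := Walk.exists_getVert_of_inner hz hzu hzv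
      refine Walk.mem_support_iff_exists_getVert.2 ⟨i - 1, ?_, ?_⟩
      · rw [Walk.take_getVert, Walk.drop_getVert]
        congr 1
        omega
      · rw [Walk.take_length, Walk.drop_length]
        omega
    · intro hz
      obtain ⟨i, rfl, hi⟩ := Walk.mem_support_iff_exists_getVert.1 hz
      rw [Walk.take_length, Walk.drop_length] at hi
      rw [Walk.take_getVert, Walk.drop_getVert]
      refine ⟨p.getVert_mem_support _, ?_, ?_⟩
      · rw [Ne, hp.getVert_eq_start_iff (by omega)]
        omega
      · rw [Ne, hp.getVert_eq_end_iff (by omega)]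
        omega
  rw [this]
  exact Walk.connected_induce_support _

theorem SimpleGraph.Walk.IsPath.getVert_mem_inner {p : G.Walk u v} (hp : p.IsPath)
    {i : ℕ} (h0 : i ≠ 0) (hi : i < p.length) :
    p.getVert i ∈ {x | x ∈ p.support ∧ x ≠ u ∧ x ≠ v} := by
  refine ⟨p.getVert_mem_support _, ?_, ?_⟩
  · rwa [Ne, hp.getVert_eq_start_iff (by omega)]
  · rw [Ne, hp.getVert_eq_end_iff (by omega)]
    omega

theorem SimpleGraph.Walk.IsPath.mem_support_dropLast {p : G.Walk u v} (hp : p.IsPath)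
    (hnil : ¬ p.Nil) {z : V} (hz : z ∈ p.dropLast.support) : z ∈ p.support ∧ z ≠ v := by
  have h := hp.support_nodup
  rw [← Walk.support_dropLast_concat hnil] at h ⊢
  rw [List.nodup_append] at h
  exact ⟨List.mem_append_left _ hz, h.2.2 z hz v (by simp)⟩

end Walks

/-! ### Edges of forests -/

section Counting

variable {V : Type*} {G : SimpleGraph V}

/-- A forest extends to a spanning tree of the complete graph, whose edges are one fewer than the
vertices. -/
theorem SimpleGraph.IsAcyclic.ncard_edgeSet_lt [Finite V] [Nonempty V] (h : G.IsAcyclic) :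
    G.edgeSet.ncard + 1 ≤ Nat.card V := by
  obtain ⟨T, hGT, -, hT⟩ := (connected_top (V := V)).exists_isTree_le_of_le_of_isAcyclic
    (le_top (a := G)) h
  have := (isTree_iff_connected_and_card.1 hT).2
  rw [Nat.card_coe_set_eq] at this
  rw [← this]
  exact Nat.add_le_add_right (Set.ncard_le_ncard (edgeSet_mono hGT) (Set.toFinite _)) 1

end Counting

/-! ### Attaching an ear to a union of disjoint paths -/

section Ears

variable {V : Type*} {G : SimpleGraph V} {k : ℕ}

/-- Two distinct paths with the same ends have total length at least the girth. -/
theorem SimpleGraph.Walk.IsPath.le_length_add_length {g : ℕ}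
    (hg : ∀ (a : V) (c : G.Walk a a), c.IsCycle → g ≤ c.length) {u v : V} {p q : G.Walk u v}
    (hp : p.IsPath) (hq : q.IsPath) (h : p ≠ q) : g ≤ p.length + q.length := by
  obtain ⟨w, -, -, c, hc, hl⟩ := hp.exists_isCycle_length_le_add_of_ne hq h
  exact (hg w c hc).trans hl

/-- Three internally disjoint paths, two of which have an additional connection between their
inner vertices, contain a `K₄`-minor. -/
theorem hasCompleteMinor_four_of_ear {u v x y : V} {P : Fin 3 → G.Walk u v} {Q : G.Walk x y}
    (huv : u ≠ v) (hP : ∀ i, (P i).IsPath) (hl : ∀ i, 2 ≤ (P i).length)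
    (hd : ∀ i j, i ≠ j → ∀ z, z ∈ (P i).support → z ∈ (P j).support → z = u ∨ z = v)
    (hQ : Q.IsPath) (hxy : x ≠ y)
    (hQP : ∀ z ∈ Q.support, z ≠ x → z ≠ y → ∀ i, z ∉ (P i).support)
    (hx : x ∈ (P 0).support) (hxu : x ≠ u) (hxv : x ≠ v)
    (hy : y ∈ (P 1).support) (hyu : y ≠ u) (hyv : y ≠ v) : HasCompleteMinor 4 G := by
  have hQnil : ¬ Q.Nil := fun h => hxy h.eq
  have hPnil : ∀ i, ¬ (P i).Nil := fun i h => huv h.eq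
  have h01 : (0 : Fin 3) ≠ 1 := by decide
  have h02 : (0 : Fin 3) ≠ 2 := by decide
  have h12 : (1 : Fin 3) ≠ 2 := by decide
  have hsnd : ∀ i, (P i).getVert 1 ∈ {z | z ∈ (P i).support ∧ z ≠ u ∧ z ≠ v} := fun i =>
    (hP i).getVert_mem_inner one_ne_zero (lt_of_lt_of_le one_lt_two (hl i))
  have hpen : ∀ i, (P i).penultimate ∈ {z | z ∈ (P i).support ∧ z ≠ u ∧ z ≠ v} := fun i =>
    (hP i).getVert_mem_inner (by have := hl i; omega) (by have := hl i; omega)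
  have hadj : ∀ i, G.Adj u ((P i).getVert 1) := fun i => (P i).adj_snd (hPnil i)
  have hadj' : ∀ i, G.Adj ((P i).penultimate) v := fun i => (P i).adj_penultimate (hPnil i)
  -- The end `u` is absorbed in the third path, while `v` is a part of its own. The inner vertices
  -- of the first two paths reach both ends, and the last edge of `Q` joins them to each other;
  -- cutting `y` off `Q` and `v` off the third path keeps the parts disjoint.
  refine hasCompleteMinor_four_of_sets
    (A := {z | z ∈ (P 0).support ∧ z ≠ u ∧ z ≠ v} ∪ {z | z ∈ Q.dropLast.support})
    (B := {z | z ∈ (P 1).support ∧ z ≠ u ∧ z ≠ v}) (C := {v}) (D := {z | z ∈ (P 2).dropLast.support})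
    ?_ ((hP 1).connected_induce_inner (hl 1)) Connected.of_subsingleton
    (Walk.connected_induce_support _) ?_ ?_ ?_ ?_ ?_ ?_ ?_ ?_ ?_ ?_ ?_ ?_
  · exact induce_union_connected ((hP 0).connected_induce_inner (hl 0)).preconnected
      (Walk.connected_induce_support _).preconnected
      ⟨x, ⟨hx, hxu, hxv⟩, Q.dropLast.start_mem_support⟩
  · rw [Set.disjoint_left]
    rintro z (⟨hz, hzu, hzv⟩ | hz) ⟨hz1, hz1u, hz1v⟩
    · rcases hd 0 1 h01 z hz hz1 with h | h
      exacts [hzu h, hzv h]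
    · obtain ⟨hzQ, hzy⟩ := hQ.mem_support_dropLast hQnil hz
      by_cases hzx : z = x
      · subst hzx
        rcases hd 0 1 h01 z hx hz1 with h | h
        exacts [hxu h, hxv h]
      · exact hQP z hzQ hzx hzy 1 hz1
  · rw [Set.disjoint_singleton_right]
    rintro (h | h)
    · exact h.2.2 rfl
    · obtain ⟨hzQ, hzy⟩ := hQ.mem_support_dropLast hQnil h
      exact hQP v hzQ hxv.symm hzy 0 (P 0).end_mem_support
  · rw [Set.disjoint_left]
    intro z hz hz2
    obtain ⟨hz2, hz2v⟩ := (hP 2).mem_support_dropLast (hPnil 2) hz2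
    rcases hz with ⟨hz, hzu, hzv⟩ | hz
    · rcases hd 0 2 h02 z hz hz2 with h | h
      exacts [hzu h, hzv h]
    · obtain ⟨hzQ, hzy⟩ := hQ.mem_support_dropLast hQnil hz
      by_cases hzx : z = x
      · subst hzx
        rcases hd 0 2 h02 z hx hz2 with h | h
        exacts [hxu h, hxv h]
      · exact hQP z hzQ hzx hzy 2 hz2
  · rw [Set.disjoint_singleton_right]
    exact fun h => h.2.2 rfl
  · rw [Set.disjoint_left]
    rintro z ⟨hz, hzu, hzv⟩ hz2
    rcases hd 1 2 h12 z hz ((hP 2).mem_support_dropLast (hPnil 2) hz2).1 with h | h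
    exacts [hzu h, hzv h]
  · rw [Set.disjoint_singleton_left]
    exact fun h => ((hP 2).mem_support_dropLast (hPnil 2) h).2 rfl
  · exact ⟨_, Or.inr Q.dropLast.end_mem_support, y, ⟨hy, hyu, hyv⟩, Q.adj_penultimate hQnil⟩
  · exact ⟨_, Or.inl (hpen 0), v, rfl, hadj' 0⟩
  · exact ⟨_, Or.inl (hsnd 0), u, (P 2).dropLast.start_mem_support, (hadj 0).symm⟩
  · exact ⟨_, hpen 1, v, rfl, hadj' 1⟩
  · exact ⟨_, hsnd 1, u, (P 2).dropLast.start_mem_support, (hadj 1).symm⟩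
  · exact ⟨v, rfl, _, (P 2).dropLast.end_mem_support, (hadj' 2).symm⟩

/-- A union of disjoint paths with a further disjoint path between the same ends. -/
theorem IsUnionOfDisjointPaths.of_cons {s : ℕ} {u v : V} {P : Fin s → G.Walk u v} {Q : G.Walk u v}
    (huv : u ≠ v) (hP : ∀ i, (P i).IsPath ∧ (P i).length = k)
    (hd : ∀ i j, i ≠ j → ∀ z, z ∈ (P i).support → z ∈ (P j).support → z = u ∨ z = v)
    (hQ : Q.IsPath) (hQl : Q.length = k)
    (hQP : ∀ z ∈ Q.support, z ≠ u → z ≠ v → ∀ i, z ∉ (P i).support)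
    (hcov : ∀ z, z ∈ Q.support ∨ ∃ i, z ∈ (P i).support)
    (hedge : ∀ e ∈ G.edgeSet, e ∈ Q.edges ∨ ∃ i, e ∈ (P i).edges) :
    IsUnionOfDisjointPaths G (s + 1) k := by
  have hQP' : ∀ i z, z ∈ Q.support → z ∈ (P i).support → z = u ∨ z = v := by
    intro i z h1 h2
    by_contra! h
    exact hQP z h1 h.1 h.2 i h2
  refine ⟨u, v, Fin.cons Q P, huv, ?_, ?_, ?_, ?_⟩
  · intro i
    refine Fin.cases ⟨hQ, hQl⟩ hP i
  · intro i j
    refine Fin.cases ?_ (fun i => ?_) i <;> refine Fin.cases ?_ (fun j => ?_) j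
    · exact fun h => absurd rfl h
    · exact fun _ z h1 h2 => hQP' j z h1 h2
    · exact fun _ z h1 h2 => hQP' i z h2 h1
    · exact fun h z h1 h2 => hd i j (fun h' => h (congrArg _ h')) z h1 h2
  · intro z
    rcases hcov z with h | ⟨i, h⟩
    · exact ⟨0, h⟩
    · exact ⟨i.succ, h⟩
  · intro e he
    rcases hedge e he with h | ⟨i, h⟩
    · exact ⟨0, h⟩
    · exact ⟨i.succ, h⟩

/-- Two internally disjoint paths form a cycle. -/
theorem SimpleGraph.Walk.IsPath.isCycle_append_reverse {u v : V} {p q : G.Walk u v}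
    (hp : p.IsPath) (hq : q.IsPath) (hl : 2 ≤ p.length)
    (hd : ∀ z, z ∈ p.support → z ∈ q.support → z = u ∨ z = v) :
    (p.append q.reverse).IsCycle := by
  refine hp.isCycle_append hq.reverse ?_ (Or.inl hl)
  intro z hz hz'
  have hpn : u ∉ p.support.tail := by
    have := hp.support_nodup
    rw [← Walk.cons_tail_support] at this
    exact (List.nodup_cons.1 this).1
  have hqn : v ∉ q.reverse.support.tail := by
    have := hq.reverse.support_nodup
    rw [← Walk.cons_tail_support] at this
    exact (List.nodup_cons.1 this).1
  rcases hd z (List.mem_of_mem_tail hz) (by simpa using List.mem_of_mem_tail hz') with rfl | rfl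
  · exact hpn hz
  · exact hqn hz'

/-- Adding a path of length `k` to a union of at least two disjoint paths of length `k` gives such
a union again, provided no `K₄`-minor and no cycle shorter than `2k` arise. -/
theorem IsUnionOfDisjointPaths.of_ear (hk : 2 ≤ k) (hG : IsCompleteMinorFree 4 G)
    (hg : ∀ (a : V) (c : G.Walk a a), c.IsCycle → 2 * k ≤ c.length)
    {s : ℕ} (hs : 2 ≤ s) {u v x y : V} {P : Fin s → G.Walk u v} {Q : G.Walk x y}
    (huv : u ≠ v) (hP : ∀ i, (P i).IsPath ∧ (P i).length = k)
    (hd : ∀ i j, i ≠ j → ∀ z, z ∈ (P i).support → z ∈ (P j).support → z = u ∨ z = v)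
    (hQ : Q.IsPath) (hQl : Q.length = k)
    (hQP : ∀ z ∈ Q.support, z ≠ x → z ≠ y → ∀ i, z ∉ (P i).support)
    (hx : ∃ i, x ∈ (P i).support) (hy : ∃ i, y ∈ (P i).support)
    (hcov : ∀ z, z ∈ Q.support ∨ ∃ i, z ∈ (P i).support)
    (hedge : ∀ e ∈ G.edgeSet, e ∈ Q.edges ∨ ∃ i, e ∈ (P i).edges) :
    ∃ s, 2 ≤ s ∧ IsUnionOfDisjointPaths G s k := by
  classical
  have hxy : x ≠ y := by
    intro h
    subst h
    have := Walk.length_eq_zero_iff.2 (Walk.isPath_iff_nil.1 hQ)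
    omega
  by_cases h1 : x = u ∧ y = v
  · obtain ⟨rfl, rfl⟩ := h1
    exact ⟨s + 1, by omega, .of_cons huv hP hd hQ hQl hQP hcov hedge⟩
  by_cases h2 : x = v ∧ y = u
  · obtain ⟨rfl, rfl⟩ := h2
    refine ⟨s + 1, by omega, .of_cons (Q := Q.reverse) huv hP hd hQ.reverse (by simpa using hQl)
      ?_ ?_ ?_⟩
    · exact fun z hz hz1 hz2 => hQP z (by simpa using hz) hz2 hz1
    · simpa using hcov
    · simpa using hedge
  -- If both ends of the ear lie on one path without being `u` and `v`, the piece between them is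
  -- shorter than `k` and closes a cycle shorter than `2k` with the ear.
  have hsame : ∀ i, x ∈ (P i).support → y ∈ (P i).support → False := by
    intro i hxi hyi
    obtain ⟨r, hr, hrl, hre⟩ := (hP i).1.exists_isPath_between hxi hyi
    rw [(hP i).2] at hrl hre
    have hrk : r.length ≠ k := by
      intro h
      rcases hre h with h | h
      exacts [h1 h, h2 h]
    have := hr.le_length_add_length hg hQ (by rintro rfl; exact hrk hQl)
    omega
  obtain ⟨i, hxi⟩ := hx
  obtain ⟨j, hyj⟩ := hy
  have hij : i ≠ j := by
    rintro rfl
    exact hsame i hxi hyj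
  have hxu : x ≠ u := by
    rintro rfl
    exact hsame j (P j).start_mem_support hyj
  have hxv : x ≠ v := by
    rintro rfl
    exact hsame j (P j).end_mem_support hyj
  have hyu : y ≠ u := by
    rintro rfl
    exact hsame i hxi (P i).start_mem_support
  have hyv : y ≠ v := by
    rintro rfl
    exact hsame i hxi (P i).end_mem_support
  -- The ear now joins inner vertices of two different paths, so a third path yields a K₄-minor.
  by_cases hm : ∃ m, m ≠ i ∧ m ≠ j
  · obtain ⟨m, hmi, hmj⟩ := hm
    have hinj : Function.Injective ![i, j, m] := by
      intro a b hab
      fin_cases a <;> fin_cases b <;> simp_all [eq_comm]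
    exact absurd (hasCompleteMinor_four_of_ear (P := fun a => P (![i, j, m] a)) huv
      (fun a => (hP _).1) (fun a => (hP _).2.symm ▸ hk) (fun a b hab => hd _ _ (hinj.ne hab)) hQ hxy
      (fun z hz hzx hzy a => hQP z hz hzx hzy _) hxi hxu hxv hyj hyu hyv) hG
  push Not at hm
  have hc : ((P i).append (P j).reverse).IsCycle :=
    (hP i).1.isCycle_append_reverse (hP j).1 ((hP i).2.symm ▸ hk) (hd i j hij)
  have hclen : ((P i).append (P j).reverse).length = 2 * k := by
    rw [Walk.length_append, Walk.length_reverse, (hP i).2, (hP j).2]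
    omega
  have hcs : ∀ z, z ∈ ((P i).append (P j).reverse).support ↔ ∃ a, z ∈ (P a).support := by
    intro z
    rw [Walk.mem_support_append_iff, Walk.support_reverse, List.mem_reverse]
    constructor
    · rintro (h | h)
      exacts [⟨i, h⟩, ⟨j, h⟩]
    · rintro ⟨a, h⟩
      by_cases hai : a = i
      · exact Or.inl (hai ▸ h)
      · exact Or.inr (hm a hai ▸ h)
  have hce : ∀ e, (∃ a, e ∈ (P a).edges) → e ∈ ((P i).append (P j).reverse).edges := by
    rintro e ⟨a, h⟩
    rw [Walk.edges_append, Walk.edges_reverse, List.mem_append, List.mem_reverse]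
    by_cases hai : a = i
    · exact Or.inl (hai ▸ h)
    · exact Or.inr (hm a hai ▸ h)
  -- With only two paths their union is a cycle of length `2k`, which may be cut at `x` and `y`
  -- instead of at `u` and `v`.
  generalize (P i).append (P j).reverse = c at hc hclen hcs hce
  have hxc : x ∈ c.support := (hcs x).2 ⟨i, hxi⟩
  have hyc : y ∈ c.support := (hcs y).2 ⟨j, hyj⟩
  obtain ⟨t, hty, htl⟩ := Walk.mem_support_iff_exists_getVert.1
    ((c.mem_support_rotate_iff x hxc).2 hyc)
  have hc' : (c.rotate x hxc).IsCycle := (Walk.isCycle_rotate hxc).2 hc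
  have hl' : (c.rotate x hxc).length = 2 * k := by rw [Walk.length_rotate, hclen]
  have ht0 : t ≠ 0 := by
    rintro rfl
    rw [Walk.getVert_zero] at hty
    exact hxy hty
  have htl' : t < (c.rotate x hxc).length := by
    refine lt_of_le_of_ne htl ?_
    rintro rfl
    rw [Walk.getVert_length] at hty
    exact hxy hty
  obtain ⟨A, B, hA, hB, hAl, hBl, hAB, hcAB, heAB⟩ := hc'.exists_split ht0 htl'
  subst hty
  have hQm : Q.getVert 1 ∈ {z | z ∈ Q.support ∧ z ≠ x ∧ z ≠ (c.rotate x hxc).getVert t} :=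
    hQ.getVert_mem_inner one_ne_zero (by omega)
  have hcAB' : ∀ z, z ∈ A.support ∨ z ∈ B.support ↔ ∃ a, z ∈ (P a).support := by
    intro z
    rw [← hcAB, Walk.mem_support_rotate_iff, hcs]
  have hne : ∀ R : G.Walk x ((c.rotate x hxc).getVert t),
      (∀ z ∈ R.support, ∃ a, z ∈ (P a).support) → R ≠ Q := by
    rintro R hR rfl
    obtain ⟨a, ha⟩ := hR _ hQm.1
    exact hQP _ hQm.1 hQm.2.1 hQm.2.2 a ha
  -- Each arc makes a cycle with the ear, so has length at least `k`; the arcs together have length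
  -- `2k`, so both have length exactly `k`.
  have hA2 := hA.le_length_add_length hg hQ (hne A fun z hz => (hcAB' z).1 (Or.inl hz))
  have hB2 := hB.le_length_add_length hg hQ (hne B fun z hz => (hcAB' z).1 (Or.inr hz))
  refine ⟨3, by omega, .of_cons (P := ![A, B]) (Q := Q) hxy ?_ ?_ hQ hQl ?_ ?_ ?_⟩
  · intro a
    fin_cases a
    · exact ⟨hA, by simp; omega⟩
    · exact ⟨hB, by simp; omega⟩
  · intro a b hab z
    fin_cases a <;> fin_cases b
    · exact absurd rfl hab
    · exact hAB z
    · exact fun h1 h2 => hAB z h2 h1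
    · exact absurd rfl hab
  · intro z hz hzx hzy a ha
    have : z ∈ A.support ∨ z ∈ B.support := by
      fin_cases a
      exacts [Or.inl ha, Or.inr ha]
    obtain ⟨a, ha⟩ := (hcAB' z).1 this
    exact hQP z hz hzx hzy a ha
  · intro z
    rcases hcov z with h | h
    · exact Or.inl h
    · rcases (hcAB' z).2 h with h | h
      exacts [Or.inr ⟨0, h⟩, Or.inr ⟨1, h⟩]
  · intro e he
    rcases hedge e he with h | h
    · exact Or.inl h
    · have := (c.rotate_edges x hxc).mem_iff.2 (hce e h)
      rcases (heAB e).1 this with h | h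
      exacts [Or.inr ⟨0, h⟩, Or.inr ⟨1, h⟩]

end Ears

/-! ### The edge bound and its equality case -/

section Bound

variable {V : Type*} {G : SimpleGraph V} {k : ℕ}

/-- The bound and its equality case for graphs with at most as many edges as vertices. -/
theorem extremal_of_ncard_edgeSet_le_card [Finite V] (hk : 2 ≤ k)
    (hg : ∀ (a : V) (c : G.Walk a a), c.IsCycle → 2 * k ≤ c.length) (hac : ¬ G.IsAcyclic)
    (hmn : G.edgeSet.ncard ≤ Nat.card V) :
    k * G.edgeSet.ncard + 2 * k ≤ k * Nat.card V + G.edgeSet.ncard ∧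
      (k * G.edgeSet.ncard + 2 * k = k * Nat.card V + G.edgeSet.ncard →
        ∃ s, 2 ≤ s ∧ IsUnionOfDisjointPaths G s k) := by
  simp only [IsAcyclic, not_forall, not_not] at hac
  obtain ⟨a, c, hc⟩ := hac
  have hcl := hg a c hc
  have hcsub : {e | e ∈ c.edges} ⊆ G.edgeSet := fun e he => c.edges_subset_edgeSet he
  have hcm : c.length ≤ G.edgeSet.ncard := by
    rw [← hc.isTrail.ncard_edges]
    exact Set.ncard_le_ncard hcsub (Set.toFinite _)
  have hcn := hc.length_le_card
  obtain ⟨d, hd⟩ := Nat.exists_eq_add_of_le hmn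
  have hkd : k * Nat.card V = k * G.edgeSet.ncard + k * d := by rw [hd, mul_add]
  -- With n = m + d the bound reads 2k ≤ m + kd, which holds because a cycle already has 2k edges.
  -- Equality forces d = 0 and m = n = 2k, so the cycle is the whole graph and splits into two
  -- halves of length `k`.
  refine ⟨by omega, fun heq => ?_⟩
  have hkd0 : k * d = 0 := by omega
  have hd0 : d = 0 := by
    rcases Nat.mul_eq_zero.1 hkd0 with h | h
    · omega
    · exact h
  have hm2 : G.edgeSet.ncard = 2 * k := by omega
  have hl2 : c.length = 2 * k := by omega
  have hcE : {e | e ∈ c.edges} = G.edgeSet :=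
    Set.eq_of_subset_of_ncard_le hcsub (by rw [hc.isTrail.ncard_edges]; omega) (Set.toFinite _)
  obtain ⟨A, B, hA, hB, hAl, hBl, hAB, hcAB, heAB⟩ :=
    hc.exists_split (t := k) (by omega) (by omega)
  have hne : a ≠ c.getVert k := by
    intro h
    have := (hc.getVert_endpoint_iff (i := k) (by omega)).1 h.symm
    omega
  refine ⟨2, le_rfl, .of_cons (P := fun _ : Fin 1 => A) (Q := B) hne (fun _ => ⟨hA, hAl⟩) ?_ hB
    (by omega) ?_ ?_ ?_⟩
  · exact fun i j hij => absurd (Subsingleton.elim i j) hij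
  · intro z hz h1 h2 _ hz'
    rcases hAB z hz' hz with h | h
    exacts [h1 h, h2 h]
  · intro z
    rcases (hcAB z).1 (hc.mem_support_of_length_eq_card (by omega) z) with h | h
    exacts [Or.inr ⟨0, h⟩, Or.inl h]
  · intro e he
    rw [← hcE] at he
    rcases (heAB e).1 he with h | h
    exacts [Or.inr ⟨0, h⟩, Or.inl h]

theorem le_length_of_isCycle_induce {g : ℕ}
    (hg : ∀ (a : V) (c : G.Walk a a), c.IsCycle → g ≤ c.length) (T : Set V) :
    ∀ (a : T) (c : (G.induce T).Walk a a), c.IsCycle → g ≤ c.length := by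
  intro a c hc
  have := hg a (c.map (Embedding.induce T).toHom)
    ((Walk.isCycle_map_iff_of_injective Subtype.val_injective).2 hc)
  exact this.trans_eq (Walk.length_map _ _)

/-- Every edge of `G` lies in `G[T]` or in a set containing all edges that meet the complement of
`T`. -/
theorem ncard_edgeSet_le_induce_add [Finite V] {T : Set V} {E : Set (Sym2 V)}
    (hE : ∀ x y, x ∉ T → G.Adj x y → s(x, y) ∈ E) :
    (∀ e ∈ G.edgeSet, e ∈ E ∨ e ∈ Sym2.map Subtype.val '' (G.induce T).edgeSet) ∧
      G.edgeSet.ncard ≤ (G.induce T).edgeSet.ncard + E.ncard := by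
  have h : ∀ e ∈ G.edgeSet, e ∈ E ∨ e ∈ Sym2.map Subtype.val '' (G.induce T).edgeSet := by
    intro e
    induction e using Sym2.ind with
    | _ x y =>
    intro he
    by_cases hx : x ∈ T
    · by_cases hy : y ∈ T
      · exact Or.inr ⟨s(⟨x, hx⟩, ⟨y, hy⟩), he, rfl⟩
      · exact Or.inl (Sym2.eq_swap ▸ hE y x hy he.symm)
    · exact Or.inl (hE x y hx he)
  refine ⟨h, ?_⟩
  calc G.edgeSet.ncard ≤ (Sym2.map Subtype.val '' (G.induce T).edgeSet ∪ E).ncard :=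
        Set.ncard_le_ncard (fun e he => (h e he).symm) (Set.toFinite _)
    _ ≤ _ := Set.ncard_union_le _ _
    _ ≤ _ := Nat.add_le_add_right (Set.ncard_image_le (Set.toFinite _)) _

theorem card_compl_add_ncard [Finite V] (S : Set V) :
    Nat.card (Sᶜ : Set V) + S.ncard = Nat.card V := by
  rw [Nat.card_coe_set_eq, add_comm, Set.ncard_add_ncard_compl]

/-- The edge bound for `K₄`-minor-free graphs without cycles shorter than `2k`, together with the
structure of the graphs attaining it. -/
theorem IsCompleteMinorFree.extremal (hk : 2 ≤ k) (n : ℕ) : ∀ (V : Type u) [Finite V]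
    (G : SimpleGraph V), Nat.card V = n → IsCompleteMinorFree 4 G →
    (∀ (a : V) (c : G.Walk a a), c.IsCycle → 2 * k ≤ c.length) → ¬ G.IsAcyclic →
    k * G.edgeSet.ncard + 2 * k ≤ k * Nat.card V + G.edgeSet.ncard ∧
      (k * G.edgeSet.ncard + 2 * k = k * Nat.card V + G.edgeSet.ncard →
        ∃ s, 2 ≤ s ∧ IsUnionOfDisjointPaths G s k) := by
  classical
  induction n using Nat.strong_induction_on with
  | _ n ih =>
  intro V _ G hn hG hg hac
  have hne : Nonempty V := by
    by_contra h
    rw [not_nonempty_iff] at h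
    exact hac IsAcyclic.of_subsingleton
  by_cases hdeg : ∀ x, 2 ≤ (G.neighborSet x).ncard
  swap
  · push Not at hdeg
    obtain ⟨w, hw⟩ := hdeg
    have hcard := card_compl_add_ncard ({w} : Set V)
    rw [Set.ncard_singleton] at hcard
    have hE := (ncard_edgeSet_le_induce_add (G := G) (T := {w}ᶜ)
      (E := (fun y => s(w, y)) '' G.neighborSet w) (by
        intro x y hx hxy
        have : x = w := by simpa using hx
        subst this
        exact ⟨y, hxy, rfl⟩)).2
    have hE2 : ((fun y => s(w, y)) '' G.neighborSet w).ncard ≤ 1 :=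
      (Set.ncard_image_le (Set.toFinite _)).trans (by omega)
    have hac' : ¬ (G.induce ({w}ᶜ : Set V)).IsAcyclic := by
      intro h
      apply hac
      intro a c hc
      -- A vertex on a cycle has degree at least two, so every cycle survives the deletion of `w`.
      have hwc : w ∉ c.support := by
        intro hwc
        have := hc.ncard_neighborSet_toSubgraph_eq_two hwc
        have := Set.ncard_le_ncard (c.toSubgraph.neighborSet_subset w) (Set.toFinite _)
        omega
      have hsub : ∀ z ∈ c.support, z ∈ ({w}ᶜ : Set V) := by
        rintro z hz rfl
        exact hwc hz
      refine h (c.induce _ hsub) ?_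
      rw [← Walk.isCycle_map_iff_of_injective (f := (Embedding.induce ({w}ᶜ : Set V)).toHom)
        Subtype.val_injective, Walk.map_induce]
      exact hc
    have hb := (ih _ (by omega) ({w}ᶜ : Set V) (G.induce ({w}ᶜ : Set V)) rfl
      (fun h => hG h.of_induce) (le_length_of_isCycle_induce hg _) hac').1
    generalize (G.induce ({w}ᶜ : Set V)).edgeSet.ncard = m' at hE hb
    generalize Nat.card ({w}ᶜ : Set V) = n' at hcard hb
    rw [← hcard]
    have hm : G.edgeSet.ncard ≤ m' + 1 := by omega
    generalize G.edgeSet.ncard = m at hm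
    -- One vertex and at most one edge are lost, so the defect of `G` exceeds that of the smaller
    -- graph by at least k - (k - 1) = 1: no equality here.
    have : k * m + 2 * k < k * (n' + 1) + m := by
      obtain ⟨j, rfl⟩ : ∃ j, k = j + 1 := ⟨k - 1, by omega⟩
      have := Nat.mul_le_mul_left j hm
      nlinarith
    exact ⟨this.le, fun h => absurd h this.ne⟩
  obtain ⟨u, v, P, Q, hP, hQ, hPQ, hin⟩ :=
    IsCompleteMinorFree.exists_paths_inner_degree_two _ V G rfl hG hdeg
  -- the longer of the two paths has length at least `k`
  obtain ⟨Q, hQ, hin, hQk⟩ : ∃ Q : G.Walk u v, Q.IsPath ∧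
      (∀ x ∈ Q.support, x ≠ u → x ≠ v → (G.neighborSet x).ncard = 2) ∧ k ≤ Q.length := by
    have := hP.le_length_add_length hg hQ hPQ
    rcases le_total k P.length with h | h
    · exact ⟨P, hP, fun x hx => hin x (Or.inl hx), h⟩
    · exact ⟨Q, hQ, fun x hx => hin x (Or.inr hx), by omega⟩
  have huv : u ≠ v := by
    intro h
    subst h
    have := Walk.length_eq_zero_iff.2 (Walk.isPath_iff_nil.1 hQ)
    omega
  let S : Set V := {x | x ∈ Q.support ∧ x ≠ u ∧ x ≠ v}
  have hcard := card_compl_add_ncard S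
  have hS : S.ncard = Q.length - 1 := hQ.ncard_inner huv
  obtain ⟨hE, hEm⟩ := ncard_edgeSet_le_induce_add (G := G) (T := Sᶜ) (E := {e | e ∈ Q.edges}) (by
    intro x y hx hxy
    rw [Set.notMem_compl_iff] at hx
    exact hQ.mem_edges_of_inner_degree_two hx.1 hx.2.1 hx.2.2 (hin x hx.1 hx.2.1 hx.2.2) hxy)
  rw [hQ.isTrail.ncard_edges] at hEm
  have huS : u ∈ Sᶜ := fun h => h.2.1 rfl
  have hvS : v ∈ Sᶜ := fun h => h.2.2 rfl
  -- If a forest remains, it has fewer edges than vertices, and restoring l - 1 vertices and at most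
  -- l edges gives m ≤ n.
  by_cases hac' : (G.induce Sᶜ).IsAcyclic
  · have : Nonempty (Sᶜ : Set V) := ⟨⟨u, huS⟩⟩
    have := hac'.ncard_edgeSet_lt
    exact extremal_of_ncard_edgeSet_le_card hk hg hac (by omega)
  obtain ⟨hb, heq⟩ := ih _ (by omega) (Sᶜ : Set V) (G.induce Sᶜ) rfl
    (fun h => hG h.of_induce) (le_length_of_isCycle_induce hg _) hac'
  -- The defect of `G` is at least that of the smaller graph plus k(l - 1) - (k - 1)l = l - k. Both
  -- terms are nonnegative, so equality makes both vanish.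
  have arith : ∀ m m' n' l n : ℕ, m ≤ m' + l → n' + (l - 1) = n → k ≤ l →
      k * m' + 2 * k ≤ k * n' + m' → k * m + 2 * k ≤ k * n + m ∧
        (k * m + 2 * k = k * n + m → l = k ∧ k * m' + 2 * k = k * n' + m') := by
    intro m m' n' l n h1 h2 h3 h4
    obtain ⟨d, hd⟩ := Nat.exists_eq_add_of_le h1
    obtain ⟨c, rfl⟩ := Nat.exists_eq_add_of_le h3
    obtain ⟨j, rfl⟩ : ∃ j, k = j + 1 := ⟨k - 1, by omega⟩
    obtain rfl : n = n' + j + c := by omega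
    have h5 := congrArg (j * ·) hd
    simp only [mul_add] at h5
    constructor
    · nlinarith
    · intro h6
      have : c = 0 := by nlinarith
      subst this
      exact ⟨rfl, by nlinarith⟩
  obtain ⟨hbound, heq'⟩ := arith _ _ _ _ _ hEm (hS ▸ hcard) hQk hb
  refine ⟨hbound, fun h => ?_⟩
  obtain ⟨hQl, h'⟩ := heq' h
  obtain ⟨s, hs, u', v', P', huv', hP', hd', hcov', hedge'⟩ := heq h'
  let f : G.induce Sᶜ →g G := (Embedding.induce Sᶜ).toHom
  have hf : Function.Injective f := Subtype.val_injective
  have hmem : ∀ i z, z ∈ ((P' i).map f).support ↔ ∃ h : z ∈ Sᶜ, (⟨z, h⟩ : (Sᶜ : Set V)) ∈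
      (P' i).support := by
    intro i z
    rw [Walk.support_map, List.mem_map]
    constructor
    · rintro ⟨y, hy, rfl⟩
      exact ⟨y.2, hy⟩
    · rintro ⟨h, hy⟩
      exact ⟨_, hy, rfl⟩
  refine IsUnionOfDisjointPaths.of_ear hk hG hg hs (u := f u') (v := f v') (P := fun i => (P' i).map f)
    (Q := Q) ?_ ?_ ?_ hQ hQl ?_ ?_ ?_ ?_ ?_
  · exact hf.ne huv'
  · exact fun i => ⟨(Walk.isPath_map_iff_of_injective hf).2 (hP' i).1,
      (Walk.length_map _ _).trans (hP' i).2⟩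
  · intro i j hij z h1 h2
    obtain ⟨hz, h1⟩ := (hmem i z).1 h1
    obtain ⟨_, h3⟩ := (hmem j z).1 h2
    exact (hd' i j hij _ h1 h3).imp (congrArg Subtype.val) (congrArg Subtype.val)
  · intro z hz h1 h2 i hzi
    exact ((hmem i z).1 hzi).1 ⟨hz, h1, h2⟩
  · obtain ⟨i, hi⟩ := hcov' ⟨u, huS⟩
    exact ⟨i, (hmem i u).2 ⟨huS, hi⟩⟩
  · obtain ⟨i, hi⟩ := hcov' ⟨v, hvS⟩
    exact ⟨i, (hmem i v).2 ⟨hvS, hi⟩⟩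
  · intro z
    by_cases hz : z ∈ S
    · exact Or.inl hz.1
    · obtain ⟨i, hi⟩ := hcov' ⟨z, hz⟩
      exact Or.inr ⟨i, (hmem i z).2 ⟨hz, hi⟩⟩
  · intro e he
    rcases hE e he with h | ⟨e, he', rfl⟩
    · exact Or.inl h
    · obtain ⟨i, hi⟩ := hedge' e he'
      refine Or.inr ⟨i, ?_⟩
      rw [Walk.edges_map]
      exact List.mem_map_of_mem hi

end Bound

/-! ### Boundaries of connected sets of degree-two vertices -/

section Boundary

variable {V : Type*} {G : SimpleGraph V}

/-- A connected set of vertices of degree two has at most two neighbours outside. -/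
theorem ncard_outer_neighbors_le_two [Finite V] {S : Set V} (hS : (G.induce S).Connected)
    (hd : ∀ x ∈ S, (G.neighborSet x).ncard = 2) :
    {y | y ∉ S ∧ ∃ x ∈ S, G.Adj x y}.ncard ≤ 2 := by
  classical
  have := Fintype.ofFinite V
  have hsplit : ∀ x : S, ((G.induce S).neighborSet x).ncard + (G.neighborSet x \ S).ncard = 2 := by
    intro x
    rw [← hd x x.2, ← Set.ncard_inter_add_ncard_sdiff_eq_ncard (G.neighborSet (x : V)) S
      (Set.toFinite _), ← Set.ncard_image_of_injective _ Subtype.val_injective]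
    congr 2
    ext y
    constructor
    · rintro ⟨z, hz, rfl⟩
      exact ⟨hz, z.2⟩
    · rintro ⟨hy, hyS⟩
      exact ⟨⟨y, hyS⟩, hy, rfl⟩
  have hsum : ∑ x : S, ((G.induce S).neighborSet x).ncard = 2 * (G.induce S).edgeSet.ncard := by
    rw [← coe_edgeFinset, Set.ncard_coe_finset, ← sum_degrees_eq_twice_card_edges]
    refine Finset.sum_congr rfl fun x _ => ?_
    rw [Set.ncard_eq_toFinset_card']
    rfl
  -- The degrees in `S` sum to 2|S|, and the at least |S| - 1 inner edges account for all but at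
  -- most two of this sum.
  have hedges := hS.card_vert_le_card_edgeSet_add_one
  rw [Nat.card_coe_set_eq (G.induce S).edgeSet] at hedges
  have htotal : ∑ x : S, (((G.induce S).neighborSet x).ncard + (G.neighborSet x \ S).ncard) =
      2 * Nat.card S := by
    rw [Finset.sum_congr rfl fun x _ => hsplit x]
    simp [Nat.card_eq_fintype_card, mul_comm]
  rw [Finset.sum_add_distrib, hsum] at htotal
  have hsub : {y | y ∉ S ∧ ∃ x ∈ S, G.Adj x y} ⊆
      ((Finset.univ.biUnion fun x : S => (G.neighborSet x \ S).toFinset : Finset V) : Set V) := by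
    rintro y ⟨hy, x, hx, hxy⟩
    simp only [Finset.coe_biUnion, Finset.mem_coe, Finset.mem_univ, Set.iUnion_true,
      Set.coe_toFinset, Set.mem_iUnion]
    exact ⟨⟨x, hx⟩, hxy, hy⟩
  have h1 := Set.ncard_le_ncard hsub (Set.toFinite _)
  rw [Set.ncard_coe_finset] at h1
  have h2 : (Finset.univ.biUnion fun x : S => (G.neighborSet x \ S).toFinset).card ≤
      ∑ x : S, (G.neighborSet x \ S).ncard := by
    refine Finset.card_biUnion_le.trans_eq (Finset.sum_congr rfl fun x _ => ?_)
    rw [Set.ncard_eq_toFinset_card']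
  omega

end Boundary

/-! ### Unions of disjoint paths: parameters, minors, girth, existence -/

section DisjointPaths

variable {V : Type*} {G : SimpleGraph V} {s k : ℕ} {u v : V} {P : Fin s → G.Walk u v}

theorem mem_edges_of_inner (hd : ∀ i j, i ≠ j → ∀ x, x ∈ (P i).support → x ∈ (P j).support →
      x = u ∨ x = v) (hedge : ∀ e ∈ G.edgeSet, ∃ i, e ∈ (P i).edges) {i : Fin s} {x y : V}
    (hx : x ∈ (P i).support) (hxu : x ≠ u) (hxv : x ≠ v) (hxy : G.Adj x y) :
    s(x, y) ∈ (P i).edges := by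
  obtain ⟨j, hj⟩ := hedge s(x, y) hxy
  by_cases hij : i = j
  · exact hij ▸ hj
  · rcases hd i j hij x hx ((P j).fst_mem_support_of_mem_edges hj) with h | h
    exacts [absurd h hxu, absurd h hxv]

theorem ncard_neighborSet_of_inner (hP : ∀ i, (P i).IsPath)
    (hd : ∀ i j, i ≠ j → ∀ x, x ∈ (P i).support → x ∈ (P j).support → x = u ∨ x = v)
    (hedge : ∀ e ∈ G.edgeSet, ∃ i, e ∈ (P i).edges) {i : Fin s} {x : V}
    (hx : x ∈ (P i).support) (hxu : x ≠ u) (hxv : x ≠ v) : (G.neighborSet x).ncard = 2 := by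
  have : G.neighborSet x = (P i).toSubgraph.neighborSet x :=
    subset_antisymm (fun y hy => (P i).adj_toSubgraph_iff_mem_edges.2
      (mem_edges_of_inner hd hedge hx hxu hxv hy)) ((P i).toSubgraph.neighborSet_subset x)
  rw [this]
  obtain ⟨t, ht0, ht, rfl⟩ := Walk.exists_getVert_of_inner hx hxu hxv
  exact (hP i).ncard_neighborSet_toSubgraph_internal_eq_two ht0 ht

/-- A shared edge would have both its ends in {`u`, `v`}, so it would be `uv`; but a path from `u`
to `v` containing that edge has length one. -/
theorem disjoint_edges_of_inner_disjoint (hP : ∀ i, (P i).IsPath) (hl : ∀ i, 2 ≤ (P i).length)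
    (hd : ∀ i j, i ≠ j → ∀ x, x ∈ (P i).support → x ∈ (P j).support → x = u ∨ x = v)
    {i j : Fin s} (hij : i ≠ j) {e : Sym2 V} (hi : e ∈ (P i).edges) (hj : e ∈ (P j).edges) :
    False := by
  induction e using Sym2.ind with
  | _ x y =>
  have hxy : x ≠ y := ((P i).adj_of_mem_edges hi).ne
  have hx := hd i j hij x ((P i).fst_mem_support_of_mem_edges hi)
    ((P j).fst_mem_support_of_mem_edges hj)
  have hy := hd i j hij y ((P i).snd_mem_support_of_mem_edges hi)
    ((P j).snd_mem_support_of_mem_edges hj)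
  have huv : s(u, v) ∈ (P i).edges := by
    rcases hx with rfl | rfl <;> rcases hy with rfl | rfl
    · exact absurd rfl hxy
    · exact hi
    · exact Sym2.eq_swap ▸ hi
    · exact absurd rfl hxy
  have := (hP i).length_eq_one_of_mem_edges huv
  have := hl i
  omega

theorem IsUnionOfDisjointPaths.card_eq [Finite V] (h : IsUnionOfDisjointPaths G s k) :
    Nat.card V = s * (k - 1) + 2 := by
  classical
  have := Fintype.ofFinite V
  obtain ⟨u, v, P, huv, hP, hd, hcov, -⟩ := h
  let F : Fin s → Finset V := fun i => (P i).support.toFinset \ {u, v}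
  have hF : ∀ i, (F i).card = k - 1 := by
    intro i
    rw [← (hP i).2, ← (hP i).1.ncard_inner huv, ← Set.ncard_coe_finset]
    congr 1
    ext x
    simp [F]
  have hdis : Set.PairwiseDisjoint (↑(Finset.univ : Finset (Fin s))) F := by
    intro i _ j _ hij
    rw [Function.onFun, Finset.disjoint_left]
    intro x hx hx'
    simp only [F, Finset.mem_sdiff, List.mem_toFinset, Finset.mem_insert, Finset.mem_singleton]
      at hx hx'
    exact hx.2 (hd i j hij x hx.1 hx'.1)
  have huniv : (Finset.univ : Finset V) = Finset.univ.biUnion F ∪ {u, v} := by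
    ext x
    obtain ⟨i, hi⟩ := hcov x
    simp only [F, Finset.mem_univ, Finset.mem_union, Finset.mem_biUnion, Finset.mem_sdiff,
      List.mem_toFinset, true_and, true_iff]
    by_cases hx : x ∈ ({u, v} : Finset V)
    · exact Or.inr hx
    · exact Or.inl ⟨i, hi, hx⟩
  rw [Nat.card_eq_fintype_card, ← Finset.card_univ, huniv, Finset.card_union_of_disjoint,
    Finset.card_biUnion hdis, Finset.sum_congr rfl fun i _ => hF i, Finset.card_pair huv]
  · simp
  · rw [Finset.disjoint_biUnion_left]
    exact fun i _ => Finset.sdiff_disjoint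

theorem IsUnionOfDisjointPaths.ncard_edgeSet [Finite V] (h : IsUnionOfDisjointPaths G s k)
    (hk : 2 ≤ k) : G.edgeSet.ncard = s * k := by
  classical
  obtain ⟨u, v, P, huv, hP, hd, -, hedge⟩ := h
  have hdis : Set.PairwiseDisjoint (↑(Finset.univ : Finset (Fin s)))
      fun i => (P i).edges.toFinset := by
    intro i _ j _ hij
    rw [Function.onFun, Finset.disjoint_left]
    intro e he he'
    rw [List.mem_toFinset] at he he'
    exact disjoint_edges_of_inner_disjoint (fun i => (hP i).1) (fun i => (hP i).2.symm ▸ hk) hd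
      hij he he'
  have huniv : G.edgeSet = ((Finset.univ.biUnion fun i => (P i).edges.toFinset :
      Finset (Sym2 V)) : Set (Sym2 V)) := by
    ext e
    simp only [Finset.coe_biUnion, Finset.mem_coe, Finset.mem_univ, Set.iUnion_true,
      List.coe_toFinset, Set.mem_iUnion]
    exact ⟨hedge e, fun ⟨i, hi⟩ => (P i).edges_subset_edgeSet hi⟩
  rw [huniv, Set.ncard_coe_finset, Finset.card_biUnion hdis,
    Finset.sum_congr rfl fun i _ => (List.toFinset_card_of_nodup
      (hP i).1.isTrail.edges_nodup).trans ((P i).length_edges.trans (hP i).2)]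
  simp

theorem IsUnionOfDisjointPaths.isCompleteMinorFree [Finite V]
    (h : IsUnionOfDisjointPaths G s k) : IsCompleteMinorFree 4 G := by
  classical
  obtain ⟨u, v, P, huv, hP, hd, hcov, hedge⟩ := h
  rintro ⟨B, hB, hdis, hadj⟩
  -- If each of the four parts met {`u`, `v`}, two of them would share `u` or share `v` by
  -- pigeonhole.
  obtain ⟨a, hua, hva⟩ : ∃ a, u ∉ B a ∧ v ∉ B a := by
    by_contra! hc
    obtain ⟨a, b, hab, hf⟩ := Fintype.exists_ne_map_eq_of_card_lt
      (fun a : Fin 4 => decide (u ∈ B a)) (by simp)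
    have hdab := Set.disjoint_left.1 (hdis a b hab)
    by_cases hu : u ∈ B a
    · exact hdab hu (by simpa [hu] using hf)
    · exact hdab (hc a hu) (hc b (by simpa [hu] using hf))
  have hO := ncard_outer_neighbors_le_two (hB a) fun x hx => by
    obtain ⟨i, hi⟩ := hcov x
    exact ncard_neighborSet_of_inner (fun i => (hP i).1) hd hedge hi
      (fun h => hua (h ▸ hx)) (fun h => hva (h ▸ hx))
  have hy : ∀ b : Fin 4, ∃ y, b ≠ a → y ∈ B b ∧ ∃ x ∈ B a, G.Adj x y := by
    intro b
    by_cases hba : b = a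
    · exact ⟨u, fun h => absurd hba h⟩
    · obtain ⟨x, hx, y, hy, hxy⟩ := hadj a b (Ne.symm hba)
      exact ⟨y, fun _ => ⟨hy, x, hx, hxy⟩⟩
  choose y hy using hy
  -- The other three parts supply three distinct outer neighbours of `B a`, one more than its
  -- boundary allows.
  have himg : (((Finset.univ.erase a).image y : Finset V) : Set V) ⊆
      {y | y ∉ B a ∧ ∃ x ∈ B a, G.Adj x y} := by
    intro z hz
    simp only [Finset.coe_image, Set.mem_image, Finset.mem_coe, Finset.mem_erase] at hz
    obtain ⟨b, ⟨hba, -⟩, rfl⟩ := hz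
    exact ⟨Set.disjoint_left.1 (hdis b a hba) (hy b hba).1, (hy b hba).2⟩
  have hcard := Set.ncard_le_ncard himg (Set.toFinite _)
  rw [Set.ncard_coe_finset, Finset.card_image_of_injOn, Finset.card_erase_of_mem
    (Finset.mem_univ a), Finset.card_univ, Fintype.card_fin] at hcard
  · omega
  · intro b hb c hc hbc
    simp only [Finset.coe_erase, Finset.coe_univ, Set.mem_sdiff, Set.mem_univ,
      Set.mem_singleton_iff, true_and] at hb hc
    by_contra hne
    exact Set.disjoint_left.1 (hdis b c hne) (hy b hb).1 (hbc ▸ (hy c hc).1)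

/-- A cycle through an inner vertex of one of the paths contains that path. -/
theorem edges_subset_of_isCycle [Finite V] (hP : ∀ i, (P i).IsPath)
    (hd : ∀ i j, i ≠ j → ∀ x, x ∈ (P i).support → x ∈ (P j).support → x = u ∨ x = v)
    (hedge : ∀ e ∈ G.edgeSet, ∃ i, e ∈ (P i).edges) {i : Fin s} (hl : 2 ≤ (P i).length)
    {x a : V} {c : G.Walk a a} (hc : c.IsCycle)
    (hx : x ∈ (P i).support) (hxu : x ≠ u) (hxv : x ≠ v) (hxc : x ∈ c.support) :
    ∀ e ∈ (P i).edges, e ∈ c.edges := by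
  -- An inner vertex has degree two, so a cycle through it uses both its edges; membership in the
  -- cycle therefore spreads along the whole path.
  have hloc : ∀ t, t ≠ 0 → t < (P i).length → (P i).getVert t ∈ c.support →
      ∀ y, G.Adj ((P i).getVert t) y → s((P i).getVert t, y) ∈ c.edges := by
    intro t ht0 ht htc y hy
    obtain ⟨h1, h2, h3⟩ := (hP i).getVert_mem_inner ht0 ht
    have := Set.eq_of_subset_of_ncard_le (c.toSubgraph.neighborSet_subset ((P i).getVert t))
      (by rw [ncard_neighborSet_of_inner hP hd hedge h1 h2 h3,
        hc.ncard_neighborSet_toSubgraph_eq_two htc]) (Set.toFinite _)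
    have hy' : y ∈ G.neighborSet ((P i).getVert t) := hy
    rw [← this] at hy'
    exact c.adj_toSubgraph_iff_mem_edges.1 hy'
  have hsucc : ∀ t, t ≠ 0 → t + 1 < (P i).length →
      ((P i).getVert t ∈ c.support ↔ (P i).getVert (t + 1) ∈ c.support) := by
    intro t ht0 ht
    have hadj := (P i).adj_getVert_succ (i := t) (by omega)
    constructor
    · exact fun h => c.snd_mem_support_of_mem_edges (hloc t ht0 (by omega) h _ hadj)
    · exact fun h => c.snd_mem_support_of_mem_edges (hloc (t + 1) (by omega) ht h _ hadj.symm)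
  have hone : ∀ t, t + 1 < (P i).length →
      ((P i).getVert (t + 1) ∈ c.support ↔ (P i).getVert 1 ∈ c.support) := by
    intro t
    induction t with
    | zero => exact fun _ => Iff.rfl
    | succ t ih => exact fun ht => (hsucc (t + 1) (by omega) ht).symm.trans (ih (by omega))
  have hall : ∀ t, t ≠ 0 → t < (P i).length → (P i).getVert t ∈ c.support := by
    obtain ⟨r, hr0, hr, rfl⟩ := Walk.exists_getVert_of_inner hx hxu hxv
    obtain ⟨r, rfl⟩ := Nat.exists_eq_succ_of_ne_zero hr0
    intro t ht0 ht
    obtain ⟨t, rfl⟩ := Nat.exists_eq_succ_of_ne_zero ht0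
    exact (hone t ht).2 ((hone r hr).1 hxc)
  intro e he
  induction e using Sym2.ind with
  | _ y z =>
  have hadj := (P i).adj_of_mem_edges he
  rw [← Walk.adj_toSubgraph_iff_mem_edges, Walk.toSubgraph_adj_iff] at he
  obtain ⟨t, hte, ht⟩ := he
  rw [← hte]
  have hadj' := (P i).adj_getVert_succ ht
  by_cases ht0 : t = 0
  · rw [Sym2.eq_swap]
    exact hloc (t + 1) (by omega) (by omega) (hall _ (by omega) (by omega)) _ hadj'.symm
  · exact hloc t ht0 ht (hall t ht0 ht) _ hadj'

theorem IsUnionOfDisjointPaths.le_length_of_isCycle [Finite V]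
    (h : IsUnionOfDisjointPaths G s k) (hk : 2 ≤ k) {a : V} {c : G.Walk a a} (hc : c.IsCycle) :
    2 * k ≤ c.length := by
  obtain ⟨u, v, P, huv, hP, hd, hcov, hedge⟩ := h
  have hP' := fun i => (hP i).1
  have hl : ∀ i, 2 ≤ (P i).length := fun i => (hP i).2.symm ▸ hk
  have hnil : ∀ i, ¬ (P i).Nil := fun i h => huv h.eq
  have hc3 := hc.three_le_length
  -- A cycle has at least three vertices, so one of them is neither `u` nor `v`.
  obtain ⟨x, hxc, hxu, hxv⟩ : ∃ x ∈ c.support, x ≠ u ∧ x ≠ v := by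
    by_contra! hcon
    have hinj := hc.getVert_injOn'
    have h01 := hinj.ne (x := 0) (y := 1) (by simp) (by simp; omega) (by omega)
    have h02 := hinj.ne (x := 0) (y := 2) (by simp) (by simp; omega) (by omega)
    have h12 := hinj.ne (x := 1) (y := 2) (by simp; omega) (by simp; omega) (by omega)
    have hor : ∀ t, c.getVert t = u ∨ c.getVert t = v := fun t =>
      or_iff_not_imp_left.2 (hcon _ (c.getVert_mem_support t))
    rcases hor 0 with h0 | h0 <;> rcases hor 1 with h1 | h1
    · exact h01 (h0.trans h1.symm)
    · rcases hor 2 with h2 | h2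
      exacts [h02 (h0.trans h2.symm), h12 (h1.trans h2.symm)]
    · rcases hor 2 with h2 | h2
      exacts [h12 (h1.trans h2.symm), h02 (h0.trans h2.symm)]
    · exact h01 (h0.trans h1.symm)
  obtain ⟨i, hi⟩ := hcov x
  have hie := edges_subset_of_isCycle hP' hd hedge (hl i) hc hi hxu hxv hxc
  have husnd : s(u, (P i).snd) ∈ c.edges :=
    hie _ ((P i).adj_toSubgraph_iff_mem_edges.1 ((P i).toSubgraph_adj_snd (hnil i)))
  have huc : u ∈ c.support := c.fst_mem_support_of_mem_edges husnd
  -- The cycle leaves `u` by a second edge. The path `P i` has only one edge at `u`, so this edge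
  -- lies on another path, which the cycle then also contains.
  obtain ⟨y, hy, hyne⟩ : ∃ y ∈ c.toSubgraph.neighborSet u, y ≠ (P i).snd :=
    Set.exists_ne_of_one_lt_ncard
      (by rw [hc.ncard_neighborSet_toSubgraph_eq_two huc]; omega) _
  have hye : s(u, y) ∈ c.edges := c.adj_toSubgraph_iff_mem_edges.1 hy
  obtain ⟨j, hj⟩ := hedge _ (c.edges_subset_edgeSet hye)
  have hij : i ≠ j := by
    rintro rfl
    exact hyne ((hP' i).eq_snd_of_mem_edges hj)
  have hyv : y ≠ v := by
    rintro rfl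
    have := (hP' j).length_eq_one_of_mem_edges hj
    have := hl j
    omega
  have hje := edges_subset_of_isCycle hP' hd hedge (hl j) hc
    ((P j).snd_mem_support_of_mem_edges hj) ((P j).adj_of_mem_edges hj).ne' hyv
    (c.snd_mem_support_of_mem_edges hye)
  calc 2 * k = {e | e ∈ (P i).edges}.ncard + {e | e ∈ (P j).edges}.ncard := by
        rw [(hP' i).isTrail.ncard_edges, (hP' j).isTrail.ncard_edges, (hP i).2, (hP j).2, two_mul]
    _ = ({e | e ∈ (P i).edges} ∪ {e | e ∈ (P j).edges}).ncard :=
        (Set.ncard_union_eq (Set.disjoint_left.2 fun e h1 h2 =>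
          disjoint_edges_of_inner_disjoint hP' hl hd hij h1 h2) (Set.toFinite _)
          (Set.toFinite _)).symm
    _ ≤ {e | e ∈ c.edges}.ncard :=
        Set.ncard_le_ncard (Set.union_subset hie hje) (Set.toFinite _)
    _ = c.length := hc.isTrail.ncard_edges

theorem IsUnionOfDisjointPaths.girth_eq [Finite V] (h : IsUnionOfDisjointPaths G s k)
    (hk : 2 ≤ k) (hs : 2 ≤ s) : G.girth = 2 * k := by
  have hle : ∀ a (c : G.Walk a a), c.IsCycle → 2 * k ≤ c.length :=
    fun _ _ hc => h.le_length_of_isCycle hk hc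
  obtain ⟨u, v, P, huv, hP, hd, -, -⟩ := h
  have hc := (hP ⟨0, by omega⟩).1.isCycle_append_reverse (hP ⟨1, by omega⟩).1
    ((hP _).2.symm ▸ hk) (hd _ _ (by simp))
  obtain ⟨a, w, hw, hgw⟩ := exists_girth_eq_length.2 fun hac => hac _ hc
  refine le_antisymm ((girth_le_length hc).trans_eq ?_) (hgw ▸ hle a w hw)
  rw [Walk.length_append, Walk.length_reverse, (hP _).2, (hP _).2, two_mul]

/-- A system of sequences of vertices meeting only in their ends gives rise to a union of disjoint
paths. -/
theorem exists_isUnionOfDisjointPaths_of_vert (huv : u ≠ v) {p : Fin s → ℕ → V}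
    (hu : ∀ i, p i 0 = u) (hv : ∀ i, p i k = v) (hinj : ∀ i, Set.InjOn (p i) {t | t ≤ k})
    (hd : ∀ i j, i ≠ j → ∀ t t', t ≤ k → t' ≤ k → p i t = p j t' → p i t = u ∨ p i t = v)
    (hcov : ∀ x, ∃ i, ∃ t ≤ k, p i t = x) : ∃ G : SimpleGraph V, IsUnionOfDisjointPaths G s k := by
  let G : SimpleGraph V := SimpleGraph.fromRel fun x y => ∃ i, ∃ t < k, x = p i t ∧ y = p i (t + 1)
  have hstep : ∀ i, ∀ t < k, G.Adj (p i t) (p i (t + 1)) := by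
    intro i t ht
    rw [SimpleGraph.fromRel_adj]
    refine ⟨fun h => ?_, Or.inl ⟨i, t, ht, rfl, rfl⟩⟩
    have := hinj i (x₁ := t) (x₂ := t + 1) ht.le ht h
    omega
  have hwalk : ∀ i, ∀ t ≤ k, ∀ z, p i t = z → ∃ q : G.Walk u z, q.length = t ∧
      q.support = (List.range (t + 1)).map (p i) ∧ ∀ r < t, s(p i r, p i (r + 1)) ∈ q.edges := by
    intro i t
    induction t with
    | zero =>
      rintro - z rfl
      refine ⟨Walk.nil.copy rfl (hu i).symm, by simp, ?_, by simp⟩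
      simp [hu]
    | succ t ih =>
      rintro ht z rfl
      obtain ⟨q, hq, hqs, hqe⟩ := ih (by omega) _ rfl
      refine ⟨q.concat (hstep i t ht), by simp [hq], ?_, ?_⟩
      · rw [Walk.support_concat, hqs, List.range_succ (n := t + 1)]
        simp
      · intro r hr
        rw [Walk.edges_concat, List.concat_eq_append, List.mem_append]
        rcases Nat.lt_succ_iff_lt_or_eq.1 hr with h | rfl
        · exact Or.inl (hqe r h)
        · exact Or.inr (by simp)
  choose P hPl hPs hPe using fun i => hwalk i k le_rfl v (hv i)
  have hmem : ∀ i x, x ∈ (P i).support ↔ ∃ t ≤ k, p i t = x := by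
    intro i x
    rw [hPs]
    simp
  refine ⟨G, u, v, P, huv, fun i => ⟨?_, hPl i⟩, ?_, ?_, ?_⟩
  · rw [Walk.isPath_def, hPs]
    refine List.Nodup.map_on (fun a ha b hb hab => hinj i ?_ ?_ hab) List.nodup_range
    · exact Nat.lt_succ_iff.1 (List.mem_range.1 ha)
    · exact Nat.lt_succ_iff.1 (List.mem_range.1 hb)
  · intro i j hij x hi hj
    obtain ⟨t, ht, rfl⟩ := (hmem i x).1 hi
    obtain ⟨t', ht', h⟩ := (hmem j _).1 hj
    exact hd i j hij t t' ht ht' h.symm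
  · intro x
    obtain ⟨i, h⟩ := hcov x
    exact ⟨i, (hmem i x).2 h⟩
  · intro e
    induction e using Sym2.ind with
    | _ x y =>
    intro he
    rw [mem_edgeSet, SimpleGraph.fromRel_adj] at he
    rcases he.2 with ⟨i, t, ht, rfl, rfl⟩ | ⟨i, t, ht, rfl, rfl⟩
    · exact ⟨i, hPe i t ht⟩
    · exact ⟨i, Sym2.eq_swap ▸ hPe i t ht⟩

theorem exists_isUnionOfDisjointPaths (hk : 2 ≤ k) (hs : 2 ≤ s) :
    ∃ G : SimpleGraph (Fin (s * (k - 1) + 2)), IsUnionOfDisjointPaths G s k := by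
  let e : (Fin s × Fin (k - 1)) ⊕ Fin 2 ≃ Fin (s * (k - 1) + 2) :=
    (Equiv.sumCongr finProdFinEquiv (Equiv.refl _)).trans finSumFinEquiv
  -- The two values of `Fin 2` are the common ends, and position t with 0 < t < k is inner vertex
  -- number t - 1 of its path. Positions beyond `k` also get the second end, but are never used.
  let p : Fin s → ℕ → (Fin s × Fin (k - 1)) ⊕ Fin 2 := fun i t =>
    if t = 0 then Sum.inr 0 else if h : t - 1 < k - 1 then Sum.inl (i, ⟨t - 1, h⟩) else Sum.inr 1
  have h0 : ∀ i, p i 0 = Sum.inr 0 := fun i => rfl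
  have hpk : ∀ i, p i k = Sum.inr 1 := by
    intro i
    simp only [p]
    rw [if_neg (by omega), dif_neg (by omega)]
  have hin : ∀ i t (h0 : t ≠ 0) (h : t < k), p i t = Sum.inl (i, ⟨t - 1, by omega⟩) := by
    intro i t h0 h
    simp only [p]
    rw [if_neg h0, dif_pos (by omega)]
  have hcases : ∀ t ≤ k, t = 0 ∨ t = k ∨ t ≠ 0 ∧ t < k := by
    intro t ht
    omega
  refine exists_isUnionOfDisjointPaths_of_vert (u := e (Sum.inr 0)) (v := e (Sum.inr 1))
    (p := fun i t => e (p i t)) ?_ (fun i => congrArg e (h0 i)) (fun i => congrArg e (hpk i))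
    ?_ ?_ ?_
  · exact e.injective.ne (by simp)
  · intro i t ht t' ht' h
    have h : p i t = p i t' := e.injective h
    rcases hcases t ht with rfl | rfl | ⟨h1, h2⟩ <;>
      rcases hcases t' ht' with rfl | rfl | ⟨h1', h2'⟩
    · rfl
    · simp [h0, hpk] at h
    · simp [h0, hin i t' h1' h2'] at h
    · simp [h0, hpk] at h
    · rfl
    · simp [hpk, hin i t' h1' h2'] at h
    · simp [h0, hin i t h1 h2] at h
    · simp [hpk, hin i t h1 h2] at h
    · simp [hin i t h1 h2, hin i t' h1' h2'] at h
      omega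
  · intro i j hij t t' ht ht' h
    have h : p i t = p j t' := e.injective h
    rcases hcases t ht with rfl | rfl | ⟨h1, h2⟩
    · exact Or.inl (congrArg e (h0 i))
    · exact Or.inr (congrArg e (hpk i))
    · rcases hcases t' ht' with rfl | rfl | ⟨h1', h2'⟩
      · simp [h0, hin i t h1 h2] at h
      · simp [hpk, hin i t h1 h2] at h
      · simp [hin i t h1 h2, hin j t' h1' h2', hij] at h
  · intro x
    obtain ⟨y, rfl⟩ := e.surjective x
    rcases y with ⟨i, t⟩ | t
    · refine ⟨i, t + 1, by omega, congrArg e ?_⟩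
      rw [hin i _ (by omega) (by omega)]
      simp
    · fin_cases t
      · exact ⟨⟨0, by omega⟩, 0, by omega, congrArg e (h0 _)⟩
      · exact ⟨⟨0, by omega⟩, k, le_rfl, congrArg e (hpk _)⟩

end DisjointPaths

/-! ### From the fractional bound to natural numbers, and the main result -/

/-- Clearing denominators in the edge bound. -/
theorem edge_bound_sub_eq {k : ℕ} (hk : 2 ≤ k) (m n : ℕ) :
    ((k : ℝ) / ((k : ℝ) - 1) * ((n : ℝ) - 2) - m) * ((k : ℝ) - 1) =
      (k * n + m : ℕ) - (k * m + 2 * k : ℕ) := by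
  have hk' : (2 : ℝ) ≤ k := by exact_mod_cast hk
  have hk1 : (k : ℝ) - 1 ≠ 0 := by linarith
  push_cast
  field_simp
  ring

theorem edge_bound_iff {k : ℕ} (hk : 2 ≤ k) (m n : ℕ) :
    (m : ℝ) ≤ (k : ℝ) / ((k : ℝ) - 1) * ((n : ℝ) - 2) ↔ k * m + 2 * k ≤ k * n + m := by
  have hk' : (2 : ℝ) ≤ k := by exact_mod_cast hk
  have hk1 : 0 < (k : ℝ) - 1 := by linarith
  rw [← sub_nonneg, ← mul_nonneg_iff_of_pos_right hk1, edge_bound_sub_eq hk, sub_nonneg,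
    Nat.cast_le]

theorem edge_bound_eq_iff {k : ℕ} (hk : 2 ≤ k) (m n : ℕ) :
    (m : ℝ) = (k : ℝ) / ((k : ℝ) - 1) * ((n : ℝ) - 2) ↔ k * m + 2 * k = k * n + m := by
  have hk' : (2 : ℝ) ≤ k := by exact_mod_cast hk
  have hk1 : (k : ℝ) - 1 ≠ 0 := by linarith
  rw [eq_comm, ← sub_eq_zero, ← mul_eq_zero_iff_right hk1, edge_bound_sub_eq hk, sub_eq_zero,
    Nat.cast_inj, eq_comm]

theorem proposition2 (k : ℕ) (hk : 2 ≤ k) :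
    -- the upper bound
    (∀ (V : Type u) [Finite V] (G : SimpleGraph V),
      IsCompleteMinorFree 4 G → G.girth = 2 * k →
        (G.edgeSet.ncard : ℝ) ≤ (k : ℝ) / ((k : ℝ) - 1) * ((Nat.card V : ℝ) - 2)) ∧
    (∀ s : ℕ, 2 ≤ s →
      -- for `n = s (k - 1) + 2` the graphs formed by `s` paths of length `k` exist
      (∃ G : SimpleGraph (Fin (s * (k - 1) + 2)), IsUnionOfDisjointPaths G s k) ∧
      -- and all of them attain the bound
      (∀ (V : Type u) [Finite V] (G : SimpleGraph V), IsUnionOfDisjointPaths G s k →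
        Nat.card V = s * (k - 1) + 2 ∧ IsCompleteMinorFree 4 G ∧ G.girth = 2 * k ∧
          (G.edgeSet.ncard : ℝ) = (k : ℝ) / ((k : ℝ) - 1) * ((Nat.card V : ℝ) - 2)) ∧
      -- and they are the only graphs on `n` vertices that attain it
      (∀ (V : Type u) [Finite V] (G : SimpleGraph V), Nat.card V = s * (k - 1) + 2 →
        IsCompleteMinorFree 4 G → G.girth = 2 * k →
        (G.edgeSet.ncard : ℝ) = (k : ℝ) / ((k : ℝ) - 1) * ((Nat.card V : ℝ) - 2) →
          IsUnionOfDisjointPaths G s k)) := by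
  have main : ∀ (V : Type u) [Finite V] (G : SimpleGraph V),
      IsCompleteMinorFree 4 G → G.girth = 2 * k →
      k * G.edgeSet.ncard + 2 * k ≤ k * Nat.card V + G.edgeSet.ncard ∧
      (k * G.edgeSet.ncard + 2 * k = k * Nat.card V + G.edgeSet.ncard →
        ∃ s, 2 ≤ s ∧ IsUnionOfDisjointPaths G s k) := by
    intro V _ G hG hg
    refine IsCompleteMinorFree.extremal hk _ V G rfl hG
      (fun a c hc => hg ▸ girth_le_length hc) fun hac => ?_
    -- An acyclic graph has girth 0 by convention, which contradicts girth `2 * k`.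
    rw [girth_eq_zero.2 hac] at hg
    omega
  refine ⟨fun V _ G hG hg => (edge_bound_iff hk _ _).2 (main V G hG hg).1, fun s hs =>
    ⟨exists_isUnionOfDisjointPaths hk hs, fun V _ G h => ?_, fun V _ G hn hG hg hm => ?_⟩⟩
  · have hn := h.card_eq
    refine ⟨hn, h.isCompleteMinorFree, h.girth_eq hk hs, ?_⟩
    rw [edge_bound_eq_iff hk, h.ncard_edgeSet hk, hn]
    obtain ⟨j, rfl⟩ : ∃ j, k = j + 1 := ⟨k - 1, by omega⟩
    rw [Nat.add_sub_cancel]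
    ring
  · obtain ⟨s', hs', h⟩ := (main V G hG hg).2 ((edge_bound_eq_iff hk _ _).1 hm)
    -- The number of paths is determined by the number of vertices, because k - 1 is positive.
    have hn' := h.card_eq
    rw [hn, Nat.add_right_cancel_iff] at hn'
    have : s = s' := Nat.eq_of_mul_eq_mul_right (by omega) hn'
    rwa [this]
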